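/- Let $X$ be a complex Hilbert space, $A\in\mathcal L(X)$, $N\ge 1$, $\alpha\ge 1$, $\beta,\gamma\ge 0$ with $\beta+\gamma\ge\alpha$. Write $\mathbb D=\{|z|<1\}$, $\mathbb T=\{|z|=1\}$, $R(\lambda,A)=(\lambda-A)^{-1}$, let $\sigma$ and $\sigma_p$ denote the spectrum and the point spectrum, and let $d(\varphi,\psi)\in[0,\pi]$ be the arc length between $e^{i\varphi}$ and $e^{i\psi}$ on $\mathbb T$. Assume that 1. $A^nx\to 0$ as $n\to\infty$ for every $x\in X$, and $\sigma(A)\cap\mathbb T=\{e^{i\varphi_k}\}_{k=1}^N$ with $d_A=\min_{k\ne l}d(\varphi_k,\varphi_l)>0$ (no condition on $d_A$ if $N=1$); moreover there are $M_A\ge1$ and $0<\varepsilon_A\le\min\{\pi/8,d_A/3\}$ such that for every $k$ $$\sup_{0<d(\varphi,\varphi_k)\le\varepsilon_A} d(\varphi,\varphi_k)^\alpha\|R(e^{i\varphi},A)\|\le M_A ,$$ and $\|R(e^{i\varphi},A)\|\le M_A$ whenever $d(\varphi,\varphi_k)>\varepsilon_A$ for all $k$. Put $\Lambda_k=1-e^{-i\varphi_k}A$;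 these operators, and their adjoints $\Lambda_k^*=1-e^{i\varphi_k}A^*$, are bounded, injective and sectorial, so that their fractional powers $\Lambda_k^{\beta}$, $(\Lambda_k^*)^{\gamma}$ are bounded injective operators with (possibly unbounded) inverses $\Lambda_k^{-\beta}$, $(\Lambda_k^*)^{-\gamma}$. Then there exists $\delta>0$ (depending only on the data above) such that the following holds for all $p\in\mathbb N$, $B\in\mathcal L(\mathbb C^p,X)$ and $C\in\mathcal L(X,\mathbb C^p)$ that satisfy, for every $k$, 2. $\operatorname{ran}(B)\subset\operatorname{ran}(\Lambda_k^{\beta})$ and $\operatorname{ran}(C^*)\subset\operatorname{ran}((\Lambda_k^*)^{\gamma})$ (so that $\Lambda_k^{-\beta}B$ and $(\Lambda_k^*)^{-\gamma}C^*$ are bounded operators from $\mathbb C^p$ to $X$): if $$\|\Lambda_k^{-\beta}B\|<\delta\quad\text{and}\quad\|(\Lambda_k^*)^{-\gamma}C^*\|<\delta\qquad\text{for all }k,$$ then $\sigma(A+BC)\subset\mathbb D\cup\{e^{i\varphi_k}\}_{k=1}^N$ and $\{e^{i\varphi_k}\}_{k=1}^N\subset\sigma(A+BC)\setminus\sigma_p(A+BC)$.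 Moreover, every $\lambda\in\mathbb C\setminus(\mathbb D\cup\{e^{i\varphi_k}\}_{k=1}^N)$ lies in the resolvent set of $A$, the operator $1-CR(\lambda,A)B$ is boundedly invertible for every such $\lambda$, and $$\sup_{\lambda\notin\mathbb D\cup\{e^{i\varphi_k}\}_k}\|(1-CR(\lambda,A)B)^{-1}\|<\infty .$$ -/

import Mathlib

open Complex MeasureTheory

noncomputable section

/-- Strong stability of the discrete semigroup `(Aⁿ)`: `Aⁿ x → 0` for every `x`. -/
def StronglyStable {X : Type*} [NormedAddCommGroup X] [InnerProductSpace ℂ X]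
    (A : X →L[ℂ] X) : Prop :=
  ∀ x : X, Filter.Tendsto (fun n : ℕ => (A ^ n) x) Filter.atTop (nhds 0)

/-- The point `e^{iφ}` of the unit circle. -/
def circlePt (φ : ℝ) : ℂ := exp (φ * I)

/-- The arc length between the points `e^{iφ}` and `e^{iψ}` of the unit circle, that is,
`|φ - ψ|` computed modulo `2π` (a number in `[0, π]`). -/
def arcDist (φ ψ : ℝ) : ℝ := ‖((φ - ψ : ℝ) : Real.Angle)‖

/-- The operator `1 - e^{-iφ} A`. -/
def Lam {X : Type*} [NormedAddCommGroup X] [InnerProductSpace ℂ X]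
    (A : X →L[ℂ] X) (φ : ℝ) : X →L[ℂ] X :=
  1 - circlePt (-φ) • A

/-- For `0 < s < 1`, the fractional power `S ^ s` of a bounded sectorial operator `S`, by the
Balakrishnan formula `S ^ s = (sin (π s) / π) ∫₀^∞ t ^ (s - 1) (t + S)⁻¹ S dt`. -/
def balakrishnan {X : Type*} [NormedAddCommGroup X] [InnerProductSpace ℂ X]
    (S : X →L[ℂ] X) (s : ℝ) : X →L[ℂ] X :=
  ((Real.sin (Real.pi * s) / Real.pi : ℝ) : ℂ) •
    ∫ t in Set.Ioi (0 : ℝ),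
      ((t ^ (s - 1) : ℝ) : ℂ) • (Ring.inverse ((t : ℂ) • (1 : X →L[ℂ] X) + S) * S)

/-- The fractional power `S ^ r`, `r ≥ 0`, of a bounded sectorial operator `S`: the usual power
if `r` is an integer, and `S ^ n * S ^ s` if `r = n + s` with `n` an integer and `0 < s < 1`. -/
def fracPow {X : Type*} [NormedAddCommGroup X] [InnerProductSpace ℂ X]
    (S : X →L[ℂ] X) (r : ℝ) : X →L[ℂ] X :=
  if Int.fract r = 0 then S ^ ⌊r⌋₊ else S ^ ⌊r⌋₊ * balakrishnan S (Int.fract r)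

/-- The operator `S⁻¹ B`, for a bounded injective operator `S` with the (possibly unbounded)
inverse `S⁻¹ : ran S → X`, and an operator `B` on a finite-dimensional space with
`ran B ⊆ ran S`. It is the only bounded operator `B₀` with `S B₀ = B`; the lemmas below show that
it exists and is unique. -/
def invComp {X Y : Type*} [NormedAddCommGroup X] [InnerProductSpace ℂ X]
    [NormedAddCommGroup Y] [NormedSpace ℂ Y]
    (S : X →L[ℂ] X) (B : Y →L[ℂ] X) : Y →L[ℂ] X :=
  open Classical in
  if h : ∃ B₀ : Y →L[ℂ] X, S ∘L B₀ = B then h.choose else 0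

theorem comp_invComp {X Y : Type*} [NormedAddCommGroup X] [InnerProductSpace ℂ X]
    [NormedAddCommGroup Y] [NormedSpace ℂ Y] [FiniteDimensional ℂ Y]
    (S : X →L[ℂ] X) (B : Y →L[ℂ] X) (hB : Set.range B ⊆ Set.range S) :
    S ∘L invComp S B = B := by
  have h : ∃ B₀ : Y →L[ℂ] X, S ∘L B₀ = B := by
    let b := Module.finBasis ℂ Y
    choose f hf using fun y : Y => hB ⟨y, rfl⟩
    refine ⟨LinearMap.toContinuousLinearMap (b.constr ℂ fun i => f (b i)), ?_⟩
    have h1 : (S : X →ₗ[ℂ] X) ∘ₗ (b.constr ℂ fun i => f (b i)) = (B : Y →ₗ[ℂ] X) := by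
      refine b.ext fun i => ?_
      simp [hf]
    ext y
    exact LinearMap.congr_fun h1 y
  unfold invComp
  rw [dif_pos h]
  exact h.choose_spec

theorem invComp_eq {X Y : Type*} [NormedAddCommGroup X] [InnerProductSpace ℂ X]
    [NormedAddCommGroup Y] [NormedSpace ℂ Y]
    (S : X →L[ℂ] X) (hS : Function.Injective S) (B B₀ : Y →L[ℂ] X) (h₀ : S ∘L B₀ = B) :
    invComp S B = B₀ := by
  have h : ∃ B₀ : Y →L[ℂ] X, S ∘L B₀ = B := ⟨B₀, h₀⟩
  unfold invComp
  rw [dif_pos h]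
  ext y
  apply hS
  have := h.choose_spec.trans h₀.symm
  exact DFunLike.congr_fun this y

/-- The standing assumption on the operator `A`: the semigroup `(Aⁿ)` is strongly stable, the
spectrum of `A` meets the unit circle in exactly the `N` distinct points `e^{iφ_k}`, and the
resolvent grows at most like `|φ - φ_k|^{-α}` near these points on the circle and is bounded on
the rest of the circle. -/
structure SemigroupAssumption {X : Type*} [NormedAddCommGroup X] [InnerProductSpace ℂ X]
    (A : X →L[ℂ] X) {N : ℕ} (φ : Fin N → ℝ) (α : ℝ) : Prop where
  stable : StronglyStable A
  spec : spectrum ℂ A ∩ Metric.sphere (0 : ℂ) 1 = Set.range fun k => circlePt (φ k)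
  growth : ∃ M ε : ℝ, 1 ≤ M ∧ 0 < ε ∧ ε ≤ Real.pi / 8 ∧
    (∀ k l, k ≠ l → ε ≤ arcDist (φ k) (φ l) / 3) ∧
    (∀ k, ∀ θ : ℝ, 0 < arcDist θ (φ k) → arcDist θ (φ k) ≤ ε →
      arcDist θ (φ k) ^ α * ‖resolvent A (circlePt θ)‖ ≤ M) ∧
    (∀ θ : ℝ, (∀ k, ε < arcDist θ (φ k)) → ‖resolvent A (circlePt θ)‖ ≤ M)

/-- The standing assumption on the operators `B` and `C`:
`ran B ⊆ ran (1 - e^{-iφ_k} A)^β` and `ran C* ⊆ ran (1 - e^{iφ_k} A*)^γ` for every `k`. -/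
structure PerturbationAssumption {X : Type*} [NormedAddCommGroup X] [InnerProductSpace ℂ X]
    [CompleteSpace X] (A : X →L[ℂ] X) {N : ℕ} (φ : Fin N → ℝ) (β γ : ℝ) {p : ℕ}
    (B : EuclideanSpace ℂ (Fin p) →L[ℂ] X) (C : X →L[ℂ] EuclideanSpace ℂ (Fin p)) : Prop where
  range_B : ∀ k, Set.range B ⊆ Set.range (fracPow (Lam A (φ k)) β)
  range_C : ∀ k, Set.range (ContinuousLinearMap.adjoint C) ⊆
    Set.range (fracPow (ContinuousLinearMap.adjoint (Lam A (φ k))) γ)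

end

/-! Strong stability gives `‖A ^ n‖ ≤ K` by Banach–Steinhaus, so for the rotated operator a =
e^{-iφ_k}A and 0 ≤ s ≤ 1 the binomial series of (1 - a)^s converges absolutely. Up to a scalar, the
Balakrishnan integral is this series (`integral_balIntegrand`), which yields the semigroup law and
commutation.

The analytic core is that R(z,A) Λ_k^γ Λ_k^β stays bounded near e^{iφ_k}. On the circle, each power
of 1 - a gains the same power of |z - 1| (`exists_norm_resolvent_mul_le`), and β + γ ≥ α compensates
the growth of the resolvent. Outside the disc the bound follows radially, since (ρ - 1)‖R(ρz)‖ ≤ K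
for |z| = 1 and ρ > 1. Because C R(z,A) B is this operator between the small factors C₀* and B₀
(`comp_resolvent_comp_eq`), small δ makes its norm at most 1/2. A Neumann series then inverts 1 - C
R(z,A) B uniformly, and `isUnit_add_comp` gives the resolvent of A + BC.

At w = e^{iφ_k}, stability gives (ρ - 1)R(ρw,A)x → 0 as ρ decreases to 1. Together with the uniform
inverses, this forces Cx = 0 for every x with (A + BC)x = wx; then Ax = wx, so x = 0. Yet w stays in
the spectrum: if w - A - BC were invertible, its finite rank perturbation w - A would be injective,
hence invertible. -/

noncomputable section

/-! ### Binomial coefficients -/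

/-- The coefficients of the power series of `(1 - z) ^ s`. -/
def powCoeff (s : ℝ) (n : ℕ) : ℝ := (-1) ^ n * Ring.choose s n

theorem powCoeff_zero_right (s : ℝ) : powCoeff s 0 = 1 := by
  simp [powCoeff]

theorem powCoeff_succ (s : ℝ) (n : ℕ) :
    (n + 1) * powCoeff s (n + 1) = (n - s) * powCoeff s n := by
  unfold powCoeff
  rw [Ring.choose_eq_smul, Ring.choose_eq_smul, descPochhammer_succ_right,
    Polynomial.smeval_mul, Nat.factorial_succ]
  have : ((n.factorial : ℕ) : ℝ) ≠ 0 := by positivity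
  have h : ((n : ℝ) + 1) ≠ 0 := by positivity
  simp only [Polynomial.smeval_sub, Polynomial.smeval_X, Polynomial.smeval_natCast, smul_eq_mul]
  push_cast
  field_simp
  simp
  ring

theorem powCoeff_zero_left (n : ℕ) (hn : n ≠ 0) : powCoeff 0 n = 0 := by
  simp [powCoeff, Ring.choose_zero_pos ℝ (Nat.pos_of_ne_zero hn)]

theorem powCoeff_one_one : powCoeff 1 1 = -1 := by
  simp [powCoeff]

theorem powCoeff_one_left (n : ℕ) : powCoeff 1 (n + 2) = 0 := by
  induction n with
  | zero =>
    have := powCoeff_succ 1 1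
    norm_num at this ⊢
    exact this
  | succ n ih =>
    have := powCoeff_succ 1 (n + 2)
    rw [ih, mul_zero] at this
    exact (mul_eq_zero.1 this).resolve_left (by positivity)

/-- The Chu–Vandermonde identity; it becomes the semigroup law of the powers. -/
theorem sum_powCoeff_mul (s t : ℝ) (n : ℕ) :
    ∑ ij ∈ Finset.HasAntidiagonal.antidiagonal n, powCoeff s ij.1 * powCoeff t ij.2 =
      powCoeff (s + t) n := by
  unfold powCoeff
  rw [Ring.add_choose_eq n (Commute.all s t), Finset.mul_sum]
  refine Finset.sum_congr rfl fun ij hij => ?_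
  rw [← Finset.HasAntidiagonal.mem_antidiagonal.1 hij, pow_add]
  ring

/-! ### Kernel integrals on the half-line -/

theorem integrableOn_rpow_div_add {s : ℝ} (hs : 0 < s) (hs1 : s < 1) {r : ℝ} (hr : 0 < r) :
    IntegrableOn (fun t : ℝ => t ^ (s - 1) / (t + r)) (Set.Ioi 0) := by
  rw [← Set.Ioc_union_Ioi_eq_Ioi zero_le_one]
  refine IntegrableOn.union ?_ ?_
  · have h : IntegrableOn (fun t : ℝ => t ^ (s - 1) * r⁻¹) (Set.Ioc 0 1) := by
      refine Integrable.mul_const ?_ _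
      exact (intervalIntegral.intervalIntegrable_rpow' (a := 0) (b := 1)
        (r := s - 1) (by linarith)).1
    refine Integrable.mono' h (by fun_prop : Measurable _).aestronglyMeasurable ?_
    filter_upwards [ae_restrict_mem measurableSet_Ioc] with t ht
    have := ht.1
    rw [Real.norm_of_nonneg (by positivity), div_eq_mul_inv]
    gcongr
    linarith
  · have h : IntegrableOn (fun t : ℝ => t ^ (s - 2)) (Set.Ioi 1) :=
      integrableOn_Ioi_rpow_of_lt (by linarith) one_pos
    refine Integrable.mono' h (by fun_prop : Measurable _).aestronglyMeasurable ?_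
    filter_upwards [ae_restrict_mem measurableSet_Ioi] with t ht
    have ht0 : 0 < t := one_pos.trans ht
    rw [Real.norm_of_nonneg (by positivity), show s - 2 = s - 1 - 1 by ring,
      Real.rpow_sub_one ht0.ne' (s - 1)]
    gcongr
    linarith

/-- The integral `∫₀^∞ t ^ (s - 1) / (t + 1) dt`. -/
def rpowKernelIntegral (s : ℝ) : ℝ := ∫ t in Set.Ioi (0 : ℝ), t ^ (s - 1) / (t + 1)

theorem rpowKernelIntegral_pos {s : ℝ} (hs : 0 < s) (hs1 : s < 1) : 0 < rpowKernelIntegral s := by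
  unfold rpowKernelIntegral
  rw [setIntegral_pos_iff_support_of_nonneg_ae _ (integrableOn_rpow_div_add hs hs1 one_pos)]
  · have : (Function.support fun t : ℝ => t ^ (s - 1) / (t + 1)) ∩ Set.Ioi 0 = Set.Ioi 0 := by
      refine Set.inter_eq_right.2 fun t ht => ?_
      have ht : 0 < t := ht
      exact (by positivity : t ^ (s - 1) / (t + 1) ≠ 0)
    rw [this]
    simp
  · filter_upwards [ae_restrict_mem measurableSet_Ioi] with t ht
    have ht : 0 < t := ht
    simp only [Pi.zero_apply]
    positivity

/-- Scaling t ↦ rt. With r = |z - 1| this is the source of the factor |z - 1|^(s - 1) in the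
resolvent estimates. -/
theorem integral_rpow_div_add {s : ℝ} {r : ℝ} (hr : 0 < r) :
    ∫ t in Set.Ioi (0 : ℝ), t ^ (s - 1) / (t + r) = r ^ (s - 1) * rpowKernelIntegral s := by
  have h := integral_comp_mul_left_Ioi (fun t : ℝ => t ^ (s - 1) / (t + r)) 0 hr
  rw [mul_zero, smul_eq_mul, ← div_eq_inv_mul, eq_div_iff hr.ne'] at h
  rw [← h, rpowKernelIntegral, ← integral_mul_const, ← integral_const_mul]
  refine setIntegral_congr_fun measurableSet_Ioi fun t ht => ?_
  have ht : 0 < t := ht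
  rw [Real.mul_rpow hr.le ht.le]
  field_simp

theorem integrableOn_rpow_div_pow {s : ℝ} (hs : 0 < s) (hs1 : s < 1) (n : ℕ) :
    IntegrableOn (fun t : ℝ => t ^ s / (1 + t) ^ (n + 2)) (Set.Ioi 0) := by
  refine Integrable.mono' (integrableOn_rpow_div_add hs hs1 one_pos)
    (by fun_prop : Measurable _).aestronglyMeasurable ?_
  filter_upwards [ae_restrict_mem measurableSet_Ioi] with t ht
  have ht : 0 < t := ht
  rw [Real.norm_of_nonneg (by positivity), Real.rpow_sub_one ht.ne', div_div,
    div_le_div_iff_of_pos_left (by positivity) (by positivity) (by positivity)]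
  have h1 : (1 : ℝ) ≤ (1 + t) ^ n := one_le_pow₀ (by linarith)
  calc t * (t + 1) ≤ (1 + t) ^ 2 := by nlinarith
    _ ≤ (1 + t) ^ n * (1 + t) ^ 2 := le_mul_of_one_le_left (by positivity) h1
    _ = (1 + t) ^ (n + 2) := by ring

theorem tendsto_rpow_div_pow {s : ℝ} (n : ℕ) (hs : s < n) :
    Filter.Tendsto (fun t : ℝ => t ^ s / (1 + t) ^ n) Filter.atTop (nhds 0) := by
  have h : Filter.Tendsto (fun t : ℝ => t ^ (-((n : ℝ) - s))) Filter.atTop (nhds 0) :=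
    tendsto_rpow_neg_atTop (by linarith)
  refine tendsto_of_tendsto_of_tendsto_of_le_of_le' tendsto_const_nhds h ?_ ?_
  · filter_upwards [Filter.eventually_gt_atTop 0] with t ht
    positivity
  · filter_upwards [Filter.eventually_gt_atTop 0] with t ht
    rw [neg_sub, Real.rpow_sub ht, Real.rpow_natCast]
    gcongr
    linarith

theorem integral_rpow_div_sq {s : ℝ} (hs : 0 < s) (hs1 : s < 1) :
    ∫ t in Set.Ioi (0 : ℝ), t ^ s / (1 + t) ^ 2 = s * rpowKernelIntegral s := by
  have hI1 := (integrableOn_rpow_div_add hs hs1 one_pos).const_mul s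
  have hI2 : IntegrableOn (fun t : ℝ => t ^ s / (1 + t) ^ 2) (Set.Ioi 0) :=
    integrableOn_rpow_div_pow hs hs1 0
  have h := integral_Ioi_of_hasDerivAt_of_tendsto (E := ℝ) (a := 0) (m := 0)
    (f := fun t : ℝ => t ^ s / (1 + t) ^ 1)
    (f' := fun t : ℝ => s * (t ^ (s - 1) / (t + 1)) - t ^ s / (1 + t) ^ 2) ?_ ?_
    (by exact Integrable.sub hI1 hI2)
    (tendsto_rpow_div_pow 1 (by simpa using hs1))
  · rw [integral_sub hI1 hI2, integral_const_mul, Real.zero_rpow hs.ne'] at h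
    unfold rpowKernelIntegral
    linarith
  · refine ContinuousAt.continuousWithinAt ?_
    refine ContinuousAt.div (Real.continuousAt_rpow_const _ _ (Or.inr hs.le)) (by fun_prop)
      (by norm_num)
  · intro t ht
    have ht : 0 < t := ht
    have h1 : HasDerivAt (fun t : ℝ => (1 + t) ^ 1) 1 t := by
      simpa using (hasDerivAt_id t).const_add 1
    have := (Real.hasDerivAt_rpow_const (p := s) (Or.inl ht.ne')).div h1 (by positivity)
    refine this.congr_deriv ?_
    rw [Real.rpow_sub_one ht.ne']
    field_simp
    ring

/-- Integrate the derivative of t^(s+1)/(1+t)^(n+2), after writing t = (1 + t) - 1; the boundary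
terms vanish. The recursion is that of `powCoeff_succ`, shifted by one. -/
theorem integral_rpow_div_pow_succ {s : ℝ} (hs : 0 < s) (hs1 : s < 1) (n : ℕ) :
    (n + 2) * ∫ t in Set.Ioi (0 : ℝ), t ^ s / (1 + t) ^ (n + 3) =
      (n + 1 - s) * ∫ t in Set.Ioi (0 : ℝ), t ^ s / (1 + t) ^ (n + 2) := by
  have hI1 := (integrableOn_rpow_div_pow hs hs1 (n + 1)).const_mul ((n : ℝ) + 2)
  have hI2 := (integrableOn_rpow_div_pow hs hs1 n).const_mul ((n : ℝ) + 1 - s)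
  have h := integral_Ioi_of_hasDerivAt_of_tendsto (E := ℝ) (a := 0) (m := 0)
    (f := fun t : ℝ => t ^ (s + 1) / (1 + t) ^ (n + 2))
    (f' := fun t : ℝ => (n + 2) * (t ^ s / (1 + t) ^ (n + 1 + 2)) -
      (n + 1 - s) * (t ^ s / (1 + t) ^ (n + 2))) ?_ ?_ (hI1.sub hI2)
    (tendsto_rpow_div_pow (n + 2) (by push_cast; linarith))
  · rw [integral_sub hI1 hI2, integral_const_mul, integral_const_mul,
      Real.zero_rpow (by linarith)] at h
    simp only [zero_div, sub_zero] at h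
    exact sub_eq_zero.1 h
  · refine ContinuousAt.continuousWithinAt ?_
    refine ContinuousAt.div (Real.continuousAt_rpow_const _ _ (Or.inr (by linarith)))
      (by fun_prop) (by norm_num)
  · intro t ht
    have ht : 0 < t := ht
    have h1 : HasDerivAt (fun t : ℝ => (1 + t) ^ (n + 2)) ((n + 2) * (1 + t) ^ (n + 1)) t := by
      have := ((hasDerivAt_id t).const_add 1).pow (n + 2)
      simp only [id, Nat.cast_add, Nat.cast_ofNat, mul_one] at this
      exact this
    have := (Real.hasDerivAt_rpow_const (p := s + 1) (Or.inl ht.ne')).div h1 (by positivity)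
    refine this.congr_deriv ?_
    rw [add_sub_cancel_right, Real.rpow_add_one ht.ne']
    field_simp
    ring

theorem integral_rpow_div_pow {s : ℝ} (hs : 0 < s) (hs1 : s < 1) (n : ℕ) :
    ∫ t in Set.Ioi (0 : ℝ), t ^ s / (1 + t) ^ (n + 2) =
      -(rpowKernelIntegral s * powCoeff s (n + 1)) := by
  induction n with
  | zero =>
    have := powCoeff_succ s 0
    rw [powCoeff_zero_right] at this
    simp only [Nat.cast_zero, zero_add] at this ⊢
    rw [integral_rpow_div_sq hs hs1]
    linear_combination rpowKernelIntegral s * this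
  | succ n ih =>
    have h1 := integral_rpow_div_pow_succ hs hs1 n
    have h2 := powCoeff_succ s (n + 1)
    push_cast at h2
    rw [ih] at h1
    refine mul_left_cancel₀ (by positivity : (n : ℝ) + 2 ≠ 0) ?_
    rw [show n + 1 + 2 = n + 3 by ring, h1]
    linear_combination rpowKernelIntegral s * h2

/-! ### Signs and summability of the coefficients -/

theorem powCoeff_nonpos {s : ℝ} (hs : 0 < s) (hs1 : s < 1) (n : ℕ) : powCoeff s (n + 1) ≤ 0 := by
  induction n with
  | zero =>
    have := powCoeff_succ s 0
    rw [powCoeff_zero_right] at this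
    norm_num at this ⊢
    linarith
  | succ n ih =>
    have := powCoeff_succ s (n + 1)
    push_cast at this
    have h : powCoeff s (n + 1 + 1) = (n + 1 - s) / (n + 1 + 1) * powCoeff s (n + 1) := by
      field_simp
      linarith
    rw [h]
    refine mul_nonpos_of_nonneg_of_nonpos (div_nonneg ?_ (by positivity)) ih
    have : (0 : ℝ) ≤ n := by positivity
    linarith

/-- The partial sums of the coefficients of `(1 - z) ^ s` are nonnegative; they are, up to
normalization, the coefficients of `(1 - z) ^ (s - 1)`. -/
theorem sum_powCoeff_nonneg {s : ℝ} (hs1 : s < 1) (n : ℕ) :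
    0 ≤ ∑ k ∈ Finset.range (n + 1), powCoeff s k := by
  have hpos : ∀ n : ℕ, 0 ≤ powCoeff (s - 1) n := by
    intro n
    induction n with
    | zero => simp [powCoeff_zero_right]
    | succ n ih =>
      have h := powCoeff_succ (s - 1) n
      have h0 : (0 : ℝ) ≤ n := by positivity
      have : 0 ≤ (n + 1) * powCoeff (s - 1) (n + 1) := by
        rw [h]
        exact mul_nonneg (by linarith) ih
      exact nonneg_of_mul_nonneg_right this (by positivity)
  have hsum : ∑ k ∈ Finset.range (n + 1), powCoeff s k = powCoeff (s - 1) n := by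
    have h1 : ∀ n, powCoeff (s - 1) (n + 1) = powCoeff (s - 1) n + powCoeff s (n + 1) := by
      intro n
      unfold powCoeff
      have := Ring.choose_succ_succ (s - 1) n
      rw [sub_add_cancel] at this
      rw [this]
      ring
    induction n with
    | zero => simp [powCoeff_zero_right]
    | succ n ih => rw [Finset.sum_range_succ, ih, ← h1]
  rw [hsum]
  exact hpos n

/-- For 0 < s < 1 the coefficients after the leading 1 are nonpositive while the partial sums are
nonnegative, so their absolute values sum to at most 1. At the endpoints only finitely many
coefficients survive. -/
theorem summable_abs_powCoeff {s : ℝ} (hs : 0 ≤ s) (hs1 : s ≤ 1) :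
    Summable fun n => |powCoeff s n| := by
  rcases hs.eq_or_lt with rfl | hs
  · refine summable_of_ne_finset_zero (s := {0}) fun n hn => ?_
    rw [powCoeff_zero_left n (by simpa using hn), abs_zero]
  rcases hs1.eq_or_lt with rfl | hs1
  · rw [← summable_nat_add_iff 2]
    simp [powCoeff_one_left]
  · rw [← summable_nat_add_iff 1]
    refine summable_of_sum_range_le (c := 1) (fun _ => abs_nonneg _) fun n => ?_
    have := sum_powCoeff_nonneg hs1 n
    rw [Finset.sum_range_succ', powCoeff_zero_right] at this
    simp_rw [abs_of_nonpos (powCoeff_nonpos hs hs1 _), Finset.sum_neg_distrib]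
    linarith

/-! ### Resolvents and binomial series of power-bounded elements -/

section PowerBounded

variable {𝔸 : Type*} [NormedRing 𝔸] [NormedAlgebra ℂ 𝔸]

theorem resolvent_mul_sub {a : 𝔸} {z : ℂ} (hz : z ∈ resolventSet ℂ a) :
    resolvent a z * (algebraMap ℂ 𝔸 z - a) = 1 :=
  Ring.inverse_mul_cancel _ hz

theorem sub_mul_resolvent {a : 𝔸} {z : ℂ} (hz : z ∈ resolventSet ℂ a) :
    (algebraMap ℂ 𝔸 z - a) * resolvent a z = 1 :=
  Ring.mul_inverse_cancel _ hz

theorem commute_resolvent {a b : 𝔸} (h : Commute a b) {z : ℂ} (hz : z ∈ resolventSet ℂ a) :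
    Commute (resolvent a z) b := by
  have h1 : Commute (algebraMap ℂ 𝔸 z - a) b := Commute.sub_left (Algebra.commutes z b) h
  have e1 := resolvent_mul_sub hz
  have e2 := sub_mul_resolvent hz
  calc resolvent a z * b = resolvent a z * (b * ((algebraMap ℂ 𝔸 z - a) * resolvent a z)) := by
        rw [e2, mul_one]
    _ = resolvent a z * (algebraMap ℂ 𝔸 z - a) * b * resolvent a z := by
        rw [← mul_assoc b, ← h1.eq]; simp only [mul_assoc]
    _ = b * resolvent a z := by rw [e1, one_mul]

theorem one_sub_mul_resolvent {a : 𝔸} {z : ℂ} (hz : z ∈ resolventSet ℂ a) :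
    (1 - a) * resolvent a z = 1 - (z - 1) • resolvent a z := by
  have h := sub_mul_resolvent hz
  rw [sub_mul, Algebra.algebraMap_eq_smul_one, smul_one_mul, sub_eq_iff_eq_add] at h
  rw [sub_smul, one_smul, sub_mul, one_mul, h]
  abel

theorem resolvent_sub_resolvent {a : 𝔸} {z w : ℂ} (hz : z ∈ resolventSet ℂ a)
    (hw : w ∈ resolventSet ℂ a) :
    resolvent a z - resolvent a w = (w - z) • (resolvent a z * resolvent a w) := by
  have e : (w - z) • (1 : 𝔸) = (algebraMap ℂ 𝔸 w - a) - (algebraMap ℂ 𝔸 z - a) := by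
    rw [sub_smul, Algebra.algebraMap_eq_smul_one, Algebra.algebraMap_eq_smul_one]
    abel
  calc resolvent a z - resolvent a w
      = resolvent a z * ((algebraMap ℂ 𝔸 w - a) * resolvent a w)
        - resolvent a z * (algebraMap ℂ 𝔸 z - a) * resolvent a w := by
        rw [resolvent_mul_sub hz, sub_mul_resolvent hw, one_mul, mul_one]
    _ = resolvent a z * ((algebraMap ℂ 𝔸 w - a) - (algebraMap ℂ 𝔸 z - a)) * resolvent a w := by
        noncomm_ring
    _ = _ := by rw [← e, mul_smul_one, smul_mul_assoc]

/-- The power series of `(1 - z) ^ s` evaluated at `a`. -/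
def powSeries (s : ℝ) (a : 𝔸) : 𝔸 := ∑' n, (powCoeff s n : ℂ) • a ^ n

variable {a : 𝔸} {K : ℝ}

theorem summable_norm_powSeries (hK : ∀ n, ‖a ^ n‖ ≤ K) {s : ℝ} (hs : 0 ≤ s) (hs1 : s ≤ 1) :
    Summable fun n => ‖(powCoeff s n : ℂ) • a ^ n‖ := by
  refine Summable.of_nonneg_of_le (fun _ => norm_nonneg _) (fun n => ?_)
    ((summable_abs_powCoeff hs hs1).mul_right K)
  rw [norm_smul, norm_real, Real.norm_eq_abs]
  gcongr
  exact hK n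

theorem powSeries_zero (a : 𝔸) : powSeries 0 a = 1 := by
  unfold powSeries
  rw [tsum_eq_single 0 fun n hn => by simp [powCoeff_zero_left n hn]]
  simp [powCoeff_zero_right]

theorem powSeries_one (a : 𝔸) : powSeries 1 a = 1 - a := by
  unfold powSeries
  rw [tsum_eq_sum (s := Finset.range 2)]
  · simp [Finset.sum_range_succ, powCoeff_zero_right, powCoeff_one_one, sub_eq_add_neg]
  · intro n hn
    obtain ⟨m, rfl⟩ := Nat.exists_eq_add_of_le' (not_lt.1 (mt Finset.mem_range.2 hn))
    simp [powCoeff_one_left]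

variable [CompleteSpace 𝔸]

theorem hasSum_resolvent (hK : ∀ n, ‖a ^ n‖ ≤ K) {z : ℂ} (hz : 1 < ‖z‖) :
    z ∈ resolventSet ℂ a ∧ HasSum (fun n : ℕ => z⁻¹ ^ (n + 1) • a ^ n) (resolvent a z) := by
  have hz0 : z ≠ 0 := norm_pos_iff.1 (one_pos.trans hz)
  have hz1 : ‖z⁻¹‖ < 1 := by rw [norm_inv]; exact inv_lt_one_of_one_lt₀ hz
  have hS : Summable fun n : ℕ => z⁻¹ ^ n • a ^ n := by
    refine Summable.of_norm_bounded (g := fun n => ‖z⁻¹‖ ^ n * K)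
      ((summable_geometric_of_lt_one (norm_nonneg _) hz1).mul_right K) fun n => ?_
    rw [norm_smul, norm_pow]
    gcongr
    exact hK n
  have hS1 : Summable fun n : ℕ => z⁻¹ ^ (n + 1) • a ^ n := by
    refine (hS.const_smul z⁻¹).congr fun n => ?_
    rw [smul_smul, pow_succ']
  have htel : HasSum (fun n : ℕ => z⁻¹ ^ n • a ^ n - z⁻¹ ^ (n + 1) • a ^ (n + 1)) 1 := by
    have h := hS.hasSum.sub ((hasSum_nat_add_iff' 1).2 hS.hasSum)
    simpa using h
  have e1 : (algebraMap ℂ 𝔸 z - a) * ∑' n : ℕ, z⁻¹ ^ (n + 1) • a ^ n = 1 := by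
    refine (hS1.hasSum.mul_left _).unique (htel.congr_fun fun n => ?_)
    rw [Algebra.algebraMap_eq_smul_one, sub_mul, smul_one_mul, smul_smul, mul_smul_comm,
      ← pow_succ' a, pow_succ' z⁻¹, ← mul_assoc, mul_inv_cancel₀ hz0, one_mul]
  have e2 : (∑' n : ℕ, z⁻¹ ^ (n + 1) • a ^ n) * (algebraMap ℂ 𝔸 z - a) = 1 := by
    refine (hS1.hasSum.mul_right _).unique (htel.congr_fun fun n => ?_)
    rw [Algebra.algebraMap_eq_smul_one, mul_sub, mul_smul_one, smul_smul, smul_mul_assoc,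
      ← pow_succ a, pow_succ' z⁻¹, ← mul_assoc, mul_inv_cancel₀ hz0, one_mul]
  have hu : z ∈ resolventSet ℂ a := ⟨⟨_, _, e1, e2⟩, rfl⟩
  refine ⟨hu, ?_⟩
  have : resolvent a z = ∑' n : ℕ, z⁻¹ ^ (n + 1) • a ^ n :=
    left_inv_eq_right_inv (resolvent_mul_sub hu) e1
  rw [this]
  exact hS1.hasSum

theorem norm_resolvent_le (hK : ∀ n, ‖a ^ n‖ ≤ K) {z : ℂ} (hz : 1 < ‖z‖) :
    ‖resolvent a z‖ ≤ K / (‖z‖ - 1) := by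
  have hz0 : 0 < ‖z‖ := one_pos.trans hz
  have hz1 : ‖z‖⁻¹ < 1 := inv_lt_one_of_one_lt₀ hz
  obtain ⟨-, h⟩ := hasSum_resolvent hK hz
  have hg : HasSum (fun n : ℕ => ‖z‖⁻¹ ^ n * (‖z‖⁻¹ * K)) ((1 - ‖z‖⁻¹)⁻¹ * (‖z‖⁻¹ * K)) :=
    (hasSum_geometric_of_lt_one (by positivity) hz1).mul_right _
  have e : K / (‖z‖ - 1) = (1 - ‖z‖⁻¹)⁻¹ * (‖z‖⁻¹ * K) := by
    have : ‖z‖ - 1 ≠ 0 := by linarith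
    have : 1 - ‖z‖⁻¹ ≠ 0 := by linarith
    field_simp
  rw [e, ← h.tsum_eq]
  refine tsum_of_norm_bounded hg fun n => ?_
  rw [norm_smul, norm_pow, norm_inv, pow_succ, mul_assoc]
  gcongr
  exact hK n

theorem hasSum_powSeries (hK : ∀ n, ‖a ^ n‖ ≤ K) {s : ℝ} (hs : 0 ≤ s) (hs1 : s ≤ 1) :
    HasSum (fun n => (powCoeff s n : ℂ) • a ^ n) (powSeries s a) :=
  (summable_norm_powSeries hK hs hs1).of_norm.hasSum

theorem powSeries_mul (hK : ∀ n, ‖a ^ n‖ ≤ K) {s t : ℝ} (hs : 0 ≤ s) (hs1 : s ≤ 1)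
    (ht : 0 ≤ t) (ht1 : t ≤ 1) : powSeries s a * powSeries t a = powSeries (s + t) a := by
  unfold powSeries
  rw [tsum_mul_tsum_eq_tsum_sum_antidiagonal_of_summable_norm
    (summable_norm_powSeries hK hs hs1) (summable_norm_powSeries hK ht ht1)]
  refine tsum_congr fun n => ?_
  rw [← sum_powCoeff_mul, ofReal_sum, Finset.sum_smul]
  refine Finset.sum_congr rfl fun ij hij => ?_
  rw [smul_mul_smul_comm, ← pow_add, Finset.HasAntidiagonal.mem_antidiagonal.1 hij, ofReal_mul]

theorem commute_powSeries (hK : ∀ n, ‖a ^ n‖ ≤ K) {s : ℝ} (hs : 0 ≤ s) (hs1 : s ≤ 1) {b : 𝔸}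
    (h : Commute a b) : Commute (powSeries s a) b := by
  have h1 := (hasSum_powSeries hK hs hs1).mul_right b
  have h2 := (hasSum_powSeries hK hs hs1).mul_left b
  refine h1.unique (h2.congr_fun fun n => ?_)
  rw [smul_mul_assoc, mul_smul_comm, (h.pow_left n).eq]

/-! ### The Balakrishnan integral as a binomial series -/

/-- The integrand of the Balakrishnan formula for `1 - a`. -/
def balIntegrand (a : 𝔸) (s t : ℝ) : 𝔸 :=
  ((t ^ (s - 1) : ℝ) : ℂ) • (resolvent a (1 + t : ℂ) * (1 - a))

theorem norm_one_add_ofReal {t : ℝ} (ht : 0 < t) : ‖(1 + t : ℂ)‖ = 1 + t := by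
  rw [← ofReal_one, ← ofReal_add, norm_real, Real.norm_of_nonneg (by linarith)]

theorem one_lt_norm_one_add_ofReal {t : ℝ} (ht : 0 < t) : 1 < ‖(1 + t : ℂ)‖ := by
  rw [norm_one_add_ofReal ht]
  linarith

theorem resolvent_mul_one_sub (hK : ∀ n, ‖a ^ n‖ ≤ K) {t : ℝ} (ht : 0 < t) :
    resolvent a (1 + t : ℂ) * (1 - a) = 1 - (t : ℂ) • resolvent a (1 + t : ℂ) := by
  have hm := (hasSum_resolvent hK (one_lt_norm_one_add_ofReal ht)).1
  rw [(commute_resolvent ((Commute.one_right a).sub_right (Commute.refl a)) hm).eq,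
    one_sub_mul_resolvent hm, add_sub_cancel_left]

theorem norm_smul_resolvent_le (hK : ∀ n, ‖a ^ n‖ ≤ K) {t : ℝ} (ht : 0 < t) :
    ‖(t : ℂ) • resolvent a (1 + t : ℂ)‖ ≤ K := by
  have h := norm_resolvent_le hK (one_lt_norm_one_add_ofReal ht)
  rw [norm_one_add_ofReal ht, add_sub_cancel_left, le_div_iff₀ ht] at h
  rwa [norm_smul, norm_real, Real.norm_of_nonneg ht.le, mul_comm]

theorem norm_resolvent_mul_one_sub_le (hK : ∀ n, ‖a ^ n‖ ≤ K) {t : ℝ} (ht : 0 < t) :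
    ‖resolvent a (1 + t : ℂ) * (1 - a)‖ ≤ 2 * K := by
  rw [resolvent_mul_one_sub hK ht]
  refine (norm_sub_le _ _).trans ?_
  have h0 := hK 0
  rw [pow_zero] at h0
  linarith [norm_smul_resolvent_le hK ht]

theorem integrableOn_balIntegrand (hK : ∀ n, ‖a ^ n‖ ≤ K) {s : ℝ} (hs : 0 < s) (hs1 : s < 1) :
    IntegrableOn (balIntegrand a s) (Set.Ioi 0) := by
  have hK0 : 0 ≤ K := (norm_nonneg _).trans (hK 0)
  -- The bound 2K is good near 0 and K‖1 - a‖/t is good near ∞; added in the form (t + 1)‖·‖ ≤ K‖1 -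
  -- a‖ + 2K, they need a single kernel.
  refine Integrable.mono' ((integrableOn_rpow_div_add hs hs1 one_pos).mul_const
    (K * ‖1 - a‖ + 2 * K)) ?_ ?_
  · refine ContinuousOn.aestronglyMeasurable (fun t ht => ?_) measurableSet_Ioi
    have ht : 0 < t := ht
    refine ContinuousAt.continuousWithinAt ?_
    unfold balIntegrand resolvent
    refine ContinuousAt.smul ?_ (ContinuousAt.mul ?_ continuousAt_const)
    · exact continuous_ofReal.continuousAt.comp
        (Real.continuousAt_rpow_const _ _ (Or.inl ht.ne'))
    · obtain ⟨u, hu⟩ := (hasSum_resolvent hK (one_lt_norm_one_add_ofReal ht)).1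
      have h1 := NormedRing.inverse_continuousAt u
      rw [hu] at h1
      refine ContinuousAt.comp (f := fun t : ℝ => algebraMap ℂ 𝔸 (1 + t) - a) h1 ?_
      simp_rw [Algebra.algebraMap_eq_smul_one]
      fun_prop
  · filter_upwards [ae_restrict_mem measurableSet_Ioi] with t ht
    have ht : 0 < t := ht
    have h1 := norm_resolvent_mul_one_sub_le hK ht
    have h2 : t * ‖resolvent a (1 + t : ℂ) * (1 - a)‖ ≤ K * ‖1 - a‖ := by
      calc t * ‖resolvent a (1 + t : ℂ) * (1 - a)‖
          = ‖((t : ℂ) • resolvent a (1 + t : ℂ)) * (1 - a)‖ := by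
            rw [smul_mul_assoc, norm_smul, norm_real, Real.norm_of_nonneg ht.le]
        _ ≤ _ := (norm_mul_le _ _).trans
            (mul_le_mul_of_nonneg_right (norm_smul_resolvent_le hK ht) (norm_nonneg _))
    unfold balIntegrand
    rw [norm_smul, norm_real, Real.norm_of_nonneg (by positivity), div_mul_eq_mul_div,
      mul_div_assoc]
    refine mul_le_mul_of_nonneg_left ?_ (by positivity)
    rw [le_div_iff₀ (by positivity)]
    linarith

/-- The scalar coefficients of the power series of the Balakrishnan integrand. -/
def balCoeff (s : ℝ) : ℕ → ℝ → ℝ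
  | 0, t => t ^ (s - 1) / (t + 1)
  | n + 1, t => -(t ^ s / (1 + t) ^ (n + 2))

theorem integrableOn_balCoeff {s : ℝ} (hs : 0 < s) (hs1 : s < 1) :
    ∀ n, IntegrableOn (balCoeff s n) (Set.Ioi 0)
  | 0 => integrableOn_rpow_div_add hs hs1 one_pos
  | n + 1 => (integrableOn_rpow_div_pow hs hs1 n).neg

theorem integral_balCoeff {s : ℝ} (hs : 0 < s) (hs1 : s < 1) :
    ∀ n, ∫ t in Set.Ioi 0, balCoeff s n t = rpowKernelIntegral s * powCoeff s n
  | 0 => by rw [powCoeff_zero_right, mul_one]; rfl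
  | n + 1 => by
    change ∫ t in Set.Ioi (0 : ℝ), -(t ^ s / (1 + t) ^ (n + 2)) = _
    rw [integral_neg, integral_rpow_div_pow hs hs1, neg_neg]

theorem integral_abs_balCoeff {s : ℝ} (hs : 0 < s) (hs1 : s < 1) (n : ℕ) :
    ∫ t in Set.Ioi 0, |balCoeff s n t| = rpowKernelIntegral s * |powCoeff s n| := by
  cases n with
  | zero =>
    rw [powCoeff_zero_right, abs_one, mul_one]
    refine setIntegral_congr_fun measurableSet_Ioi fun t ht => ?_
    have ht : 0 < t := ht
    exact abs_of_nonneg (by positivity : 0 ≤ t ^ (s - 1) / (t + 1))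
  | succ n =>
    rw [abs_of_nonpos (powCoeff_nonpos hs hs1 n), mul_neg, ← integral_rpow_div_pow hs hs1]
    refine setIntegral_congr_fun measurableSet_Ioi fun t ht => ?_
    have ht : 0 < t := ht
    exact (abs_neg _).trans (abs_of_nonneg (by positivity))

/-- Insert the Neumann series into R(1+t)(1 - a) = 1 - tR(1+t); the leading 1 affects only the
constant coefficient. -/
theorem hasSum_balIntegrand (hK : ∀ n, ‖a ^ n‖ ≤ K) (s : ℝ) {t : ℝ} (ht : 0 < t) :
    HasSum (fun n => (balCoeff s n t : ℂ) • a ^ n) (balIntegrand a s t) := by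
  have h := (hasSum_resolvent hK (one_lt_norm_one_add_ofReal ht)).2
  have h1 : HasSum (fun n => if n = 0 then (1 : 𝔸) else 0) 1 := by
    simpa using hasSum_ite_eq (0 : ℕ) (1 : 𝔸)
  have h2 := (h1.sub (h.const_smul (t : ℂ))).const_smul ((t ^ (s - 1) : ℝ) : ℂ)
  rw [← resolvent_mul_one_sub hK ht] at h2
  refine h2.congr_fun fun n => ?_
  have ht1 : (1 + t : ℂ) ≠ 0 := norm_pos_iff.1 (one_pos.trans (one_lt_norm_one_add_ofReal ht))
  cases n with
  | zero =>
    simp only [balCoeff, pow_zero, if_true, zero_add, pow_one]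
    have e : (1 : 𝔸) - (t : ℂ) • (1 + t : ℂ)⁻¹ • (1 : 𝔸) = (1 - t * (1 + t : ℂ)⁻¹) • (1 : 𝔸) := by
      rw [sub_smul, one_smul, smul_smul]
    rw [e, smul_smul]
    congr 1
    push_cast
    rw [add_comm (t : ℂ)]
    field_simp
    ring
  | succ n =>
    simp only [balCoeff, Nat.succ_ne_zero, if_false, zero_sub]
    rw [smul_smul, smul_neg, smul_smul, ← neg_smul]
    congr 1
    have : t ^ s = t ^ (s - 1) * t := by
      rw [Real.rpow_sub_one ht.ne']; field_simp
    rw [this]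
    push_cast
    rw [inv_pow]
    field_simp

/-- Termwise integration is allowed because every coefficient function has constant sign, so the L¹
norms are again multiples of |`powCoeff s n`|, which are summable. -/
theorem integral_balIntegrand (hK : ∀ n, ‖a ^ n‖ ≤ K) {s : ℝ} (hs : 0 < s) (hs1 : s < 1) :
    ∫ t in Set.Ioi 0, balIntegrand a s t = (rpowKernelIntegral s : ℂ) • powSeries s a := by
  have hint : ∀ n, Integrable (fun t => (balCoeff s n t : ℂ) • a ^ n)
      (volume.restrict (Set.Ioi 0)) := fun n =>
    (integrableOn_balCoeff hs hs1 n).ofReal.smul_const _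
  have h := hasSum_integral_of_summable_integral_norm hint ?_
  · have e1 : ∫ t in Set.Ioi 0, ∑' n, (balCoeff s n t : ℂ) • a ^ n =
        ∫ t in Set.Ioi 0, balIntegrand a s t :=
      setIntegral_congr_fun measurableSet_Ioi fun t ht => (hasSum_balIntegrand hK s ht).tsum_eq
    rw [e1] at h
    refine h.unique (((hasSum_powSeries hK hs.le hs1.le).const_smul
      (rpowKernelIntegral s : ℂ)).congr_fun fun n => ?_)
    rw [integral_smul_const, integral_complex_ofReal, integral_balCoeff hs hs1, smul_smul, ofReal_mul]
  · refine Summable.of_nonneg_of_le (fun n => integral_nonneg fun t => norm_nonneg _) (fun n => ?_)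
      (((summable_abs_powCoeff hs.le hs1.le).mul_left (rpowKernelIntegral s)).mul_right K)
    simp_rw [norm_smul, norm_real, Real.norm_eq_abs]
    rw [integral_mul_const, integral_abs_balCoeff hs hs1]
    exact mul_le_mul_of_nonneg_left (hK n)
      (mul_nonneg (rpowKernelIntegral_pos hs hs1).le (abs_nonneg _))

end PowerBounded

/-! ### Fractional powers against resolvent growth -/

section Bounds

variable {𝔸 : Type*} [NormedRing 𝔸] [NormedAlgebra ℂ 𝔸] {a : 𝔸} {K : ℝ}

theorem norm_one_sub_mul_resolvent_mul_le {z : ℂ} (hz : z ∈ resolventSet ℂ a) (T : 𝔸) :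
    ‖(1 - a) * (resolvent a z * T)‖ ≤ ‖T‖ + ‖z - 1‖ * ‖resolvent a z * T‖ := by
  rw [← mul_assoc, one_sub_mul_resolvent hz, sub_mul, one_mul, smul_mul_assoc]
  exact (norm_sub_le _ _).trans (by rw [norm_smul])

/-- Since (1 - a)R(z) = 1 - (z - 1)R(z), each factor 1 - a is traded for z - 1 at the cost of a term
free of the resolvent, which stays bounded for |z - 1| ≤ 1. -/
theorem norm_pow_one_sub_mul_resolvent_mul_le (a T : 𝔸) (q : ℕ) :
    ∃ D : ℝ, ∀ z ∈ resolventSet ℂ a, ‖z - 1‖ ≤ 1 →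
      ‖(1 - a) ^ q * (resolvent a z * T)‖ ≤ D + ‖z - 1‖ ^ q * ‖resolvent a z * T‖ := by
  induction q with
  | zero => exact ⟨0, fun z _ _ => by simp⟩
  | succ q ih =>
    obtain ⟨D, hD⟩ := ih
    refine ⟨‖(1 - a) ^ q * T‖ + |D|, fun z hz hz1 => ?_⟩
    have e : (1 - a) ^ (q + 1) * (resolvent a z * T) =
        (1 - a) ^ q * T - (z - 1) • ((1 - a) ^ q * (resolvent a z * T)) := by
      rw [pow_succ, mul_assoc, ← mul_assoc (1 - a), one_sub_mul_resolvent hz, sub_mul, one_mul,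
        smul_mul_assoc, mul_sub, mul_smul_comm]
    rw [e]
    refine (norm_sub_le _ _).trans ?_
    rw [norm_smul, add_assoc, pow_succ']
    gcongr
    calc ‖z - 1‖ * ‖(1 - a) ^ q * (resolvent a z * T)‖
        ≤ ‖z - 1‖ * (|D| + ‖z - 1‖ ^ q * ‖resolvent a z * T‖) := by
          gcongr
          exact (hD z hz hz1).trans (by gcongr; exact le_abs_self D)
      _ = ‖z - 1‖ * |D| + ‖z - 1‖ * ‖z - 1‖ ^ q * ‖resolvent a z * T‖ := by ring
      _ ≤ _ := by
          gcongr
          exact mul_le_of_le_one_left (abs_nonneg _) hz1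

variable [CompleteSpace 𝔸]

/-- The resolvent identity between 1 + t and z splits the product R(1+t)(1 - a)R(z)T into two
controlled terms over z - 1 - t. The condition `hsec` keeps z - 1 away from the positive half-line,
so this denominator is comparable to t + |z - 1|. -/
theorem norm_balIntegrand_mul_le (hK : ∀ n, ‖a ^ n‖ ≤ K) (s : ℝ) {z : ℂ}
    (hz : z ∈ resolventSet ℂ a) (hz1 : z ≠ 1)
    (hsec : ∀ t : ℝ, 0 < t → t + ‖z - 1‖ ≤ 2 * ‖(t : ℂ) - (z - 1)‖) (T : 𝔸) {t : ℝ} (ht : 0 < t) :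
    ‖balIntegrand a s t * (resolvent a z * T)‖ ≤ t ^ (s - 1) / (t + ‖z - 1‖) *
      (2 * ((2 * K + 1) * (‖T‖ + ‖z - 1‖ * ‖resolvent a z * T‖))) := by
  have hK0 : 0 ≤ K := (norm_nonneg _).trans (hK 0)
  have hr : 0 < ‖z - 1‖ := norm_pos_iff.2 (sub_ne_zero.2 hz1)
  have hm := (hasSum_resolvent hK (one_lt_norm_one_add_ofReal ht)).1
  have hne : (z - 1 - t : ℂ) ≠ 0 := by
    have := hsec t ht
    rw [← neg_sub, neg_ne_zero, ← norm_pos_iff]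
    linarith
  have e : resolvent a (1 + t : ℂ) * (1 - a) * (resolvent a z * T) =
      (z - 1 - t)⁻¹ • (resolvent a (1 + t : ℂ) * (1 - a) * T - (1 - a) * (resolvent a z * T)) := by
    have h1 := resolvent_sub_resolvent hm hz
    have hc := commute_resolvent ((Commute.one_right a).sub_right (Commute.refl a)) hm
    rw [eq_inv_smul_iff₀ hne, hc.eq, mul_assoc, mul_assoc, ← mul_sub, ← mul_assoc _ _ T, ← sub_mul,
      h1, sub_add_eq_sub_sub, smul_mul_assoc, mul_smul_comm]
  unfold balIntegrand
  rw [smul_mul_assoc, norm_smul, norm_real, Real.norm_of_nonneg (by positivity), e, norm_smul,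
    norm_inv, div_mul_eq_mul_div, mul_div_assoc]
  refine mul_le_mul_of_nonneg_left ?_ (by positivity)
  have hd : t + ‖z - 1‖ ≤ 2 * ‖z - 1 - t‖ := by
    rw [norm_sub_rev (z - 1)]
    exact hsec t ht
  have hd0 : 0 < ‖z - 1 - t‖ := norm_pos_iff.2 hne
  have hb : ‖resolvent a (1 + t : ℂ) * (1 - a) * T - (1 - a) * (resolvent a z * T)‖ ≤
      (2 * K + 1) * (‖T‖ + ‖z - 1‖ * ‖resolvent a z * T‖) := by
    have h1 : ‖resolvent a (1 + t : ℂ) * (1 - a) * T‖ ≤ 2 * K * ‖T‖ :=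
      (norm_mul_le _ _).trans
        (mul_le_mul_of_nonneg_right (norm_resolvent_mul_one_sub_le hK ht) (norm_nonneg _))
    have h2 := norm_one_sub_mul_resolvent_mul_le hz T
    have h3 : 0 ≤ 2 * K * (‖z - 1‖ * ‖resolvent a z * T‖) := by positivity
    refine (norm_sub_le _ _).trans ?_
    linarith
  rw [inv_mul_eq_div, div_le_div_iff₀ hd0 (by positivity)]
  have h0 := (norm_nonneg _).trans hb
  nlinarith [mul_le_mul hb hd (by positivity) h0]

/-- The moment-type estimate `‖(1 - a) ^ s R(z) T‖ ≲ |z - 1| ^ (s - 1) (‖T‖ + |z - 1| ‖R(z) T‖)`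
for `z` outside a sector around the half-line `[1, ∞)`. -/
theorem norm_powSeries_mul_resolvent_mul_le (hK : ∀ n, ‖a ^ n‖ ≤ K) {s : ℝ} (hs : 0 ≤ s)
    (hs1 : s < 1) {z : ℂ} (hz : z ∈ resolventSet ℂ a) (hz1 : z ≠ 1)
    (hsec : ∀ t : ℝ, 0 < t → t + ‖z - 1‖ ≤ 2 * ‖(t : ℂ) - (z - 1)‖) (T : 𝔸) :
    ‖powSeries s a * (resolvent a z * T)‖ ≤
      2 * (2 * K + 1) * (‖z - 1‖ ^ (s - 1) * (‖T‖ + ‖z - 1‖ * ‖resolvent a z * T‖)) := by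
  have hK0 : 0 ≤ K := (norm_nonneg _).trans (hK 0)
  have hr : 0 < ‖z - 1‖ := norm_pos_iff.2 (sub_ne_zero.2 hz1)
  rcases hs.eq_or_lt with rfl | hs
  · rw [powSeries_zero, one_mul, zero_sub, Real.rpow_neg_one, mul_add ‖z - 1‖⁻¹,
      inv_mul_cancel_left₀ hr.ne']
    have h1 : 0 ≤ ‖z - 1‖⁻¹ * ‖T‖ := by positivity
    have h2 : 0 ≤ ‖resolvent a z * T‖ := norm_nonneg _
    nlinarith [mul_nonneg hK0 h1, mul_nonneg hK0 h2]
  have hJ := rpowKernelIntegral_pos hs hs1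
  have h1 : ‖(∫ t in Set.Ioi 0, balIntegrand a s t) * (resolvent a z * T)‖ ≤
      ‖z - 1‖ ^ (s - 1) * rpowKernelIntegral s *
        (2 * ((2 * K + 1) * (‖T‖ + ‖z - 1‖ * ‖resolvent a z * T‖))) := by
    rw [← integral_mul_const_of_integrable (integrableOn_balIntegrand hK hs hs1),
      ← integral_rpow_div_add hr, ← integral_mul_const]
    refine norm_integral_le_of_norm_le ((integrableOn_rpow_div_add hs hs1 hr).mul_const _) ?_
    filter_upwards [ae_restrict_mem measurableSet_Ioi] with t ht
    exact norm_balIntegrand_mul_le hK s hz hz1 hsec T ht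
  rw [integral_balIntegrand hK hs hs1, smul_mul_assoc, norm_smul, norm_real,
    Real.norm_of_nonneg hJ.le] at h1
  refine le_of_mul_le_mul_left (h1.trans (le_of_eq ?_)) hJ
  ring

/-- The case T = 1 of the preceding estimate: as α ≥ 1 and |z - 1| ≤ 1, the term |z - 1|^(s - 1) is
absorbed into |z - 1|^(s - α). -/
theorem norm_powSeries_mul_resolvent_le (hK : ∀ n, ‖a ^ n‖ ≤ K) {s : ℝ} (hs : 0 ≤ s)
    (hs1 : s < 1) {α M : ℝ} (hα : 1 ≤ α) {z : ℂ} (hz : z ∈ resolventSet ℂ a) (hz1 : z ≠ 1)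
    (hr1 : ‖z - 1‖ ≤ 1)
    (hsec : ∀ t : ℝ, 0 < t → t + ‖z - 1‖ ≤ 2 * ‖(t : ℂ) - (z - 1)‖)
    (hM : ‖z - 1‖ ^ α * ‖resolvent a z‖ ≤ M) :
    ‖powSeries s a * resolvent a z‖ ≤ 2 * (2 * K + 1) * ((K + M) * ‖z - 1‖ ^ (s - α)) := by
  have hK0 : 0 ≤ K := (norm_nonneg _).trans (hK 0)
  have hr : 0 < ‖z - 1‖ := norm_pos_iff.2 (sub_ne_zero.2 hz1)
  have h := norm_powSeries_mul_resolvent_mul_le hK hs hs1 hz hz1 hsec 1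
  rw [mul_one] at h
  refine h.trans (mul_le_mul_of_nonneg_left ?_ (by positivity))
  have h1 : ‖(1 : 𝔸)‖ ≤ K := by simpa using hK 0
  have h2 : ‖resolvent a z‖ ≤ M * ‖z - 1‖ ^ (-α) := by
    rw [Real.rpow_neg hr.le, ← div_eq_mul_inv, le_div_iff₀ (by positivity), mul_comm]
    exact hM
  have h3 : ‖z - 1‖ ^ (s - 1) ≤ ‖z - 1‖ ^ (s - α) :=
    Real.rpow_le_rpow_of_exponent_ge hr hr1 (by linarith)
  calc ‖z - 1‖ ^ (s - 1) * (‖(1 : 𝔸)‖ + ‖z - 1‖ * ‖resolvent a z‖)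
      ≤ ‖z - 1‖ ^ (s - 1) * (K + ‖z - 1‖ * (M * ‖z - 1‖ ^ (-α))) := by gcongr
    _ = ‖z - 1‖ ^ (s - 1) * K + M * (‖z - 1‖ ^ (s - 1) * ‖z - 1‖ ^ (1 : ℝ) * ‖z - 1‖ ^ (-α)) := by
        rw [Real.rpow_one]; ring
    _ = ‖z - 1‖ ^ (s - 1) * K + M * ‖z - 1‖ ^ (s - α) := by
        rw [← Real.rpow_add hr, ← Real.rpow_add hr]
        congr 3
        ring
    _ ≤ ‖z - 1‖ ^ (s - α) * K + M * ‖z - 1‖ ^ (s - α) := by gcongr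
    _ = _ := by ring

/-- The resolvent of `a` at `z`, multiplied by fractional powers of `1 - a` of total order at
least `α`, is bounded near `1` if the resolvent grows at most like `|z - 1| ^ (-α)`. -/
theorem exists_norm_resolvent_mul_le (hK : ∀ n, ‖a ^ n‖ ≤ K) {α M : ℝ} (hα : 1 ≤ α) (n m : ℕ)
    {s t : ℝ} (hs : 0 ≤ s) (hs1 : s < 1) (ht : 0 ≤ t) (ht1 : t < 1)
    (h : α ≤ (n + s) + (m + t)) :
    ∃ D : ℝ, ∀ z ∈ resolventSet ℂ a, z ≠ 1 → ‖z - 1‖ ≤ 1 →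
      (∀ t : ℝ, 0 < t → t + ‖z - 1‖ ≤ 2 * ‖(t : ℂ) - (z - 1)‖) →
      ‖z - 1‖ ^ α * ‖resolvent a z‖ ≤ M →
      ‖resolvent a z * ((1 - a) ^ n * powSeries s a * ((1 - a) ^ m * powSeries t a))‖ ≤ D := by
  have hK0 : 0 ≤ K := (norm_nonneg _).trans (hK 0)
  have hca : Commute a (1 - a) := (Commute.one_right a).sub_right (Commute.refl a)
  have hcs : ∀ {s}, 0 ≤ s → s ≤ 1 → Commute (1 - a) (powSeries s a) := fun hs hs1 =>
    (commute_powSeries hK hs hs1 hca).symm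
  have hX : (1 - a) ^ n * powSeries s a * ((1 - a) ^ m * powSeries t a) =
      (1 - a) ^ (n + m) * (powSeries s a * powSeries t a) := by
    rw [mul_assoc, ← mul_assoc (powSeries s a), ← ((hcs hs hs1.le).pow_left m).eq, pow_add]
    simp only [mul_assoc]
  have hcR : ∀ {z : ℂ}, z ∈ resolventSet ℂ a → Commute (resolvent a z) (1 - a) := fun hz =>
    commute_resolvent hca hz
  set c := 2 * (2 * K + 1) with hc
  rcases Nat.eq_zero_or_pos (n + m) with hnm | hnm
  · -- the orders are `s` and `t`, and `(1 - a) ^ s (1 - a) ^ t = (1 - a) (1 - a) ^ (s + t - 1)`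
    obtain ⟨rfl, rfl⟩ : n = 0 ∧ m = 0 := by omega
    have hu0 : 0 ≤ s + t - 1 := by norm_num at h; linarith
    have hu1 : s + t - 1 < 1 := by linarith
    have hY : powSeries s a * powSeries t a = (1 - a) * powSeries (s + t - 1) a := by
      rw [powSeries_mul hK hs hs1.le ht ht1.le, ← powSeries_one,
        powSeries_mul hK zero_le_one le_rfl hu0 hu1.le]
      congr 1
      ring
    refine ⟨‖powSeries (s + t - 1) a‖ + c * (K + M), fun z hz hz1 hr1 hsec hM => ?_⟩
    have hr : 0 < ‖z - 1‖ := norm_pos_iff.2 (sub_ne_zero.2 hz1)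
    have hM0 : 0 ≤ M := le_trans (by positivity) hM
    have hb := norm_powSeries_mul_resolvent_le hK hu0 hu1 hα hz hz1 hr1 hsec hM
    rw [(commute_powSeries hK hu0 hu1.le
      (commute_resolvent (Commute.refl a) hz).symm).eq] at hb
    rw [hX, hY, pow_zero, one_mul, ← mul_assoc, (hcR hz).eq, mul_assoc]
    refine (norm_one_sub_mul_resolvent_mul_le hz _).trans (add_le_add_right ?_ _)
    calc ‖z - 1‖ * ‖resolvent a z * powSeries (s + t - 1) a‖
        ≤ ‖z - 1‖ * (c * ((K + M) * ‖z - 1‖ ^ (s + t - 1 - α))) := by gcongr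
      _ = c * (K + M) * (‖z - 1‖ ^ (1 : ℝ) * ‖z - 1‖ ^ (s + t - 1 - α)) := by
          rw [Real.rpow_one]; ring
      _ ≤ c * (K + M) := by
          rw [← Real.rpow_add hr]
          refine mul_le_of_le_one_right (by positivity) (Real.rpow_le_one hr.le hr1 ?_)
          norm_num at h
          linarith
  -- With q = n + m ≥ 1 whole powers, the powers s and t are estimated one after the other. The
  -- resulting exponents q + s - 1 and q + s + t - α are nonnegative; the first one could be
  -- negative if q = 0.
  · obtain ⟨D, hD⟩ := norm_pow_one_sub_mul_resolvent_mul_le a (powSeries s a * powSeries t a) (n + m)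
    refine ⟨D + c * (‖powSeries t a‖ + c * (K + M)), fun z hz hz1 hr1 hsec hM => ?_⟩
    have hr : 0 < ‖z - 1‖ := norm_pos_iff.2 (sub_ne_zero.2 hz1)
    have hM0 : 0 ≤ M := le_trans (by positivity) hM
    have hcRs := (commute_powSeries hK hs hs1.le
      (commute_resolvent (Commute.refl a) hz).symm).eq
    have hcRt := (commute_powSeries hK ht ht1.le
      (commute_resolvent (Commute.refl a) hz).symm).eq
    rw [hX, ← mul_assoc, ((hcR hz).pow_right _).eq, mul_assoc]
    refine (hD z hz hr1).trans (add_le_add_right ?_ _)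
    have h1 := norm_powSeries_mul_resolvent_mul_le hK hs hs1 hz hz1 hsec (powSeries t a)
    have h2 := norm_powSeries_mul_resolvent_le hK ht ht1 hα hz hz1 hr1 hsec hM
    rw [hcRt] at h2
    have hnm1 : (1 : ℝ) ≤ ((n + m : ℕ) : ℝ) := by exact_mod_cast hnm
    rw [← mul_assoc, ← hcRs, mul_assoc, ← Real.rpow_natCast]
    set q : ℝ := ((n + m : ℕ) : ℝ) with hq
    calc ‖z - 1‖ ^ q * ‖powSeries s a * (resolvent a z * powSeries t a)‖
        ≤ ‖z - 1‖ ^ q * (c * (‖z - 1‖ ^ (s - 1) *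
            (‖powSeries t a‖ + ‖z - 1‖ * (c * ((K + M) * ‖z - 1‖ ^ (t - α)))))) := by
          refine mul_le_mul_of_nonneg_left (h1.trans ?_) (by positivity)
          gcongr
      _ = c * ((‖z - 1‖ ^ q * ‖z - 1‖ ^ (s - 1)) * ‖powSeries t a‖ + c * (K + M) *
            (‖z - 1‖ ^ q * ‖z - 1‖ ^ (s - 1) * (‖z - 1‖ ^ (1 : ℝ) * ‖z - 1‖ ^ (t - α)))) := by
          rw [Real.rpow_one]; ring
      _ ≤ c * (1 * ‖powSeries t a‖ + c * (K + M) * 1) := by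
          rw [← Real.rpow_add hr, ← Real.rpow_add hr, ← Real.rpow_add hr]
          push_cast at hq
          gcongr
          · exact Real.rpow_le_one hr.le hr1 (by linarith)
          · exact Real.rpow_le_one hr.le hr1 (by linarith)
      _ = _ := by ring

end Bounds

/-! ### Arcs of the circle; fractional powers and adjoints -/

section Operators

variable {X : Type*} [NormedAddCommGroup X] [InnerProductSpace ℂ X]

theorem StronglyStable.exists_norm_pow_le [CompleteSpace X] {A : X →L[ℂ] X}
    (hA : StronglyStable A) : ∃ K : ℝ, ∀ n, ‖A ^ n‖ ≤ K := by
  refine banach_steinhaus fun x => ?_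
  obtain ⟨D, hD⟩ := (hA x).norm.bddAbove_range
  exact ⟨D, fun n => hD ⟨n, rfl⟩⟩

theorem circlePt_add (φ ψ : ℝ) : circlePt (φ + ψ) = circlePt φ * circlePt ψ := by
  unfold circlePt
  rw [← exp_add, ofReal_add, add_mul]

theorem norm_circlePt (φ : ℝ) : ‖circlePt φ‖ = 1 := norm_exp_ofReal_mul_I φ

theorem circlePt_ne_zero (φ : ℝ) : circlePt φ ≠ 0 := exp_ne_zero _

theorem circlePt_eq_of_angle_eq {φ ψ : ℝ} (h : (φ : Real.Angle) = ψ) :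
    circlePt φ = circlePt ψ := by
  obtain ⟨n, hn⟩ := Real.Angle.angle_eq_iff_two_pi_dvd_sub.1 h
  unfold circlePt
  refine exp_eq_exp_iff_exists_int.2 ⟨n, ?_⟩
  rw [show φ = ψ + 2 * Real.pi * n by linarith]
  push_cast
  ring

theorem circlePt_eq_of_arcDist_eq_zero {φ ψ : ℝ} (h : arcDist φ ψ = 0) :
    circlePt φ = circlePt ψ := by
  refine circlePt_eq_of_angle_eq ?_
  rw [arcDist, norm_eq_zero, Real.Angle.coe_sub, sub_eq_zero] at h
  exact h

theorem arcDist_eq_abs {φ ψ : ℝ} (h : |φ - ψ| ≤ Real.pi) : arcDist φ ψ = |φ - ψ| := by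
  refine (AddCircle.norm_coe_eq_abs_iff (2 * Real.pi) Real.two_pi_pos.ne').2 ?_
  rw [abs_of_pos Real.two_pi_pos]
  linarith

/-- Chord at most arc: this direction alone turns the growth bound in arc length into one in |z -
1|. -/
theorem norm_circlePt_sub_one_le (φ ψ : ℝ) : ‖circlePt (φ - ψ) - 1‖ ≤ arcDist φ ψ := by
  have h1 : circlePt (φ - ψ) = circlePt ((φ - ψ : ℝ) : Real.Angle).toReal :=
    circlePt_eq_of_angle_eq (Real.Angle.coe_toReal _).symm
  have h2 := arcDist_eq_abs (φ := ((φ - ψ : ℝ) : Real.Angle).toReal) (ψ := 0)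
    (by rw [sub_zero]; exact Real.Angle.abs_toReal_le_pi _)
  have h3 : arcDist φ ψ = arcDist ((φ - ψ : ℝ) : Real.Angle).toReal 0 := by
    rw [arcDist, arcDist, sub_zero, Real.Angle.coe_toReal]
  rw [h3, h2, sub_zero, h1, circlePt, mul_comm]
  exact Real.norm_exp_I_mul_ofReal_sub_one_le

/-- As Re(z - 1) ≤ 0, one has |t - (z - 1)|² ≥ t² + |z - 1|² ≥ (t + |z - 1|)²/2. This supplies the
condition `hsec` on the circle. -/
theorem add_norm_sub_one_le {z : ℂ} (hz : ‖z‖ = 1) {t : ℝ} (ht : 0 < t) :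
    t + ‖z - 1‖ ≤ 2 * ‖(t : ℂ) - (z - 1)‖ := by
  have h1 : ‖z - 1‖ ^ 2 = 2 - 2 * z.re := by
    have : z.re * z.re + z.im * z.im = 1 := by
      rw [← normSq_apply, normSq_eq_norm_sq, hz, one_pow]
    rw [← normSq_eq_norm_sq, normSq_apply]
    simp
    linarith
  have h2 : ‖(t : ℂ) - (z - 1)‖ ^ 2 = t ^ 2 - 2 * t * (z.re - 1) + ‖z - 1‖ ^ 2 := by
    rw [← normSq_eq_norm_sq, ← normSq_eq_norm_sq, normSq_apply, normSq_apply]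
    simp
    ring
  have h3 : z.re ≤ 1 := hz ▸ re_le_norm z
  refine le_of_sq_le_sq (a := t + ‖z - 1‖) ?_ (by positivity)
  nlinarith [sq_nonneg (t - ‖z - 1‖), mul_nonneg ht.le (sub_nonneg.2 h3), sq_nonneg (t + ‖z - 1‖)]

theorem balakrishnan_one_sub [CompleteSpace X] {a : X →L[ℂ] X} {K : ℝ} (hK : ∀ n, ‖a ^ n‖ ≤ K)
    {s : ℝ} (hs : 0 < s) (hs1 : s < 1) :
    balakrishnan (1 - a) s =
      ((Real.sin (Real.pi * s) / Real.pi * rpowKernelIntegral s : ℝ) : ℂ) • powSeries s a := by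
  rw [ofReal_mul, mul_smul, ← integral_balIntegrand hK hs hs1, balakrishnan]
  congr 2
  funext t
  rw [balIntegrand, resolvent, Algebra.algebraMap_eq_smul_one, add_smul, one_smul,
    add_comm (1 : X →L[ℂ] X), add_sub_assoc]

/-- Only boundedness and commutation are needed later, so the scalar stays unspecified and the
kernel integral is never evaluated. -/
theorem exists_fracPow_eq_smul [CompleteSpace X] {a : X →L[ℂ] X} {K : ℝ}
    (hK : ∀ n, ‖a ^ n‖ ≤ K) (r : ℝ) :
    ∃ κ : ℂ, fracPow (1 - a) r = κ • ((1 - a) ^ ⌊r⌋₊ * powSeries (Int.fract r) a) := by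
  unfold fracPow
  split_ifs with h
  · exact ⟨1, by rw [h, powSeries_zero, mul_one, one_smul]⟩
  · refine ⟨((Real.sin (Real.pi * Int.fract r) / Real.pi *
      rpowKernelIntegral (Int.fract r) : ℝ) : ℂ), ?_⟩
    rw [balakrishnan_one_sub hK ((Int.fract_nonneg r).lt_of_ne' h) (Int.fract_lt_one r),
      mul_smul_comm]

theorem commute_ringInverse_smul_one_add [CompleteSpace X] (S : X →L[ℂ] X) (t : ℂ) :
    Commute (Ring.inverse (t • (1 : X →L[ℂ] X) + S)) S := by
  by_cases h : IsUnit (t • (1 : X →L[ℂ] X) + S)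
  · obtain ⟨u, hu⟩ := h
    rw [← hu, Ring.inverse_unit]
    refine Commute.units_inv_left ?_
    rw [hu]
    exact (((Commute.one_left S).smul_left t).add_left (Commute.refl S))
  · rw [Ring.inverse_non_unit _ h]
    exact Commute.zero_left _

/-- The adjoint is a real-linear homeomorphism, so it passes through the integral without any
integrability condition. It reverses products, hence the need for S to commute with the inverse. -/
theorem star_balakrishnan [CompleteSpace X] (S : X →L[ℂ] X) (s : ℝ) :
    star (balakrishnan S s) = balakrishnan (star S) s := by
  unfold balakrishnan
  rw [star_smul]
  congr 1
  · exact conj_ofReal _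
  · have h := (starL' ℝ : (X →L[ℂ] X) ≃L[ℝ] (X →L[ℂ] X)).integral_comp_comm
      (μ := volume.restrict (Set.Ioi (0 : ℝ))) fun t => ((t ^ (s - 1) : ℝ) : ℂ) •
        (Ring.inverse ((t : ℂ) • (1 : X →L[ℂ] X) + S) * S)
    simp only [starL'_apply] at h
    rw [← h]
    congr 1
    funext t
    rw [(commute_ringInverse_smul_one_add S t).eq, star_smul, star_mul, ← Ring.inverse_star, star_add,
      star_smul, star_one]
    congr 1
    · exact conj_ofReal _
    · congr 4
      exact conj_ofReal _

theorem star_fracPow {a : X →L[ℂ] X} [CompleteSpace X] {K : ℝ} (hK : ∀ n, ‖a ^ n‖ ≤ K) (r : ℝ) :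
    star (fracPow (star (1 - a)) r) = fracPow (1 - a) r := by
  unfold fracPow
  split_ifs with h
  · rw [star_pow, star_star]
  · rw [star_mul, star_pow, star_star, star_balakrishnan, star_star,
      balakrishnan_one_sub hK ((Int.fract_nonneg r).lt_of_ne' h) (Int.fract_lt_one r)]
    exact ((commute_powSeries hK (Int.fract_nonneg r) (Int.fract_lt_one r).le
      (((Commute.one_right a).sub_right (Commute.refl a)).pow_right _)).smul_left _).eq

end Operators

/-! ### Rotation and radial extension of resolvent bounds -/

section Ring

variable {𝔸 : Type*} [NormedRing 𝔸] [NormedAlgebra ℂ 𝔸]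

theorem mem_resolventSet_smul {a : 𝔸} {w z : ℂ} (hw : w ≠ 0) (hz : z ∈ resolventSet ℂ a) :
    w * z ∈ resolventSet ℂ (w • a) ∧ resolvent a z = w • resolvent (w • a) (w * z) := by
  have e : algebraMap ℂ 𝔸 (w * z) - w • a = w • (algebraMap ℂ 𝔸 z - a) := by
    rw [Algebra.algebraMap_eq_smul_one, Algebra.algebraMap_eq_smul_one, mul_smul, smul_sub]
  have h1 : w * z ∈ resolventSet ℂ (w • a) := by
    change IsUnit _
    rw [e]
    exact (show IsUnit (algebraMap ℂ 𝔸 z - a) from hz).smul (Units.mk0 w hw)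
  refine ⟨h1, left_inv_eq_right_inv (resolvent_mul_sub hz) ?_⟩
  rw [mul_smul_comm, ← smul_mul_assoc, ← e, sub_mul_resolvent h1]

variable [CompleteSpace 𝔸] {a : 𝔸} {K : ℝ}

/-- The resolvent at `ρ z`, `ρ ≥ 1`, is controlled by the resolvent at the point `z` of the unit
circle. -/
theorem norm_resolvent_mul_le_of_norm_eq_one (hK : ∀ n, ‖a ^ n‖ ≤ K) {z : ℂ} (hz1 : ‖z‖ = 1)
    (hz : z ∈ resolventSet ℂ a) (P : 𝔸) {ρ : ℝ} (hρ : 1 ≤ ρ) :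
    ‖resolvent a (ρ * z) * P‖ ≤ (1 + K) * ‖resolvent a z * P‖ := by
  have hK0 : 0 ≤ K := (norm_nonneg _).trans (hK 0)
  rcases hρ.eq_or_lt with rfl | hρ
  · rw [ofReal_one, one_mul]
    exact le_mul_of_one_le_left (norm_nonneg _) (by linarith)
  have hn : ‖(ρ * z : ℂ)‖ = ρ := by
    rw [norm_mul, hz1, mul_one, norm_real, Real.norm_of_nonneg (by linarith)]
  have hρz : 1 < ‖(ρ * z : ℂ)‖ := by rwa [hn]
  have hw := (hasSum_resolvent hK hρz).1
  have hb := norm_resolvent_le hK hρz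
  rw [hn] at hb
  -- In the resolvent identity, |z - ρz| = ρ - 1 cancels the bound K/(ρ - 1) for R(ρz).
  have e : resolvent a (ρ * z) * P =
      resolvent a z * P + (z - ρ * z) • (resolvent a (ρ * z) * (resolvent a z * P)) := by
    rw [← mul_assoc, ← smul_mul_assoc, ← resolvent_sub_resolvent hw hz, ← add_mul,
      add_sub_cancel]
  have hd : ‖z - ρ * z‖ = ρ - 1 := by
    rw [← one_sub_mul, norm_mul, hz1, mul_one, ← ofReal_one, ← ofReal_sub, norm_real,
      Real.norm_of_nonpos (by linarith), neg_sub]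
  rw [e, add_mul, one_mul]
  refine (norm_add_le _ _).trans (add_le_add_right ?_ _)
  rw [norm_smul, hd]
  calc (ρ - 1) * ‖resolvent a (ρ * z) * (resolvent a z * P)‖
      ≤ (ρ - 1) * (K / (ρ - 1) * ‖resolvent a z * P‖) := by
        refine mul_le_mul_of_nonneg_left ?_ (by linarith)
        exact (norm_mul_le _ _).trans (mul_le_mul_of_nonneg_right hb (norm_nonneg _))
    _ = K * ‖resolvent a z * P‖ := by
        have : ρ - 1 ≠ 0 := by linarith
        field_simp

theorem continuousAt_resolvent {z : ℂ} (hz : z ∈ resolventSet ℂ a) :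
    ContinuousAt (resolvent a) z := by
  obtain ⟨u, hu⟩ := hz
  have h1 := NormedRing.inverse_continuousAt u
  rw [hu] at h1
  refine ContinuousAt.comp (f := fun z : ℂ => algebraMap ℂ 𝔸 z - a) h1 ?_
  simp_rw [Algebra.algebraMap_eq_smul_one]
  fun_prop

end Ring

/-! ### Finite rank perturbations and eigenvectors on the circle -/

section Perturbation

variable {X : Type*} [NormedAddCommGroup X] [InnerProductSpace ℂ X]

/-- The Woodbury formula: the inverse is D' - D'B(1 + CD'B)⁻¹CD'. -/
theorem isUnit_add_comp {Y : Type*} [NormedAddCommGroup Y] [NormedSpace ℂ Y] {D D' : X →L[ℂ] X}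
    (h1 : D * D' = 1) (h2 : D' * D = 1) (B : Y →L[ℂ] X) (C : X →L[ℂ] Y)
    (h : IsUnit (1 + C ∘L D' ∘L B)) : IsUnit (D + B ∘L C) := by
  obtain ⟨E, e1, e2⟩ := isUnit_iff_exists.1 h
  have h1' : ∀ x, D (D' x) = x := fun x => DFunLike.congr_fun h1 x
  have h2' : ∀ x, D' (D x) = x := fun x => DFunLike.congr_fun h2 x
  have e1' : ∀ y, C (D' (B (E y))) = y - E y := fun y =>
    eq_sub_of_add_eq' (DFunLike.congr_fun e1 y)
  have e2' : ∀ y, E (C (D' (B y))) = y - E y := fun y => by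
    have : E (y + C (D' (B y))) = y := DFunLike.congr_fun e2 y
    rw [map_add] at this
    exact eq_sub_of_add_eq' this
  refine isUnit_iff_exists.2 ⟨D' - D' ∘L B ∘L E ∘L C ∘L D', ?_, ?_⟩
  · ext x
    change D (D' x - D' (B (E (C (D' x))))) + B (C (D' x - D' (B (E (C (D' x)))))) = x
    rw [map_sub, map_sub, map_sub, h1', h1', e1', map_sub]
    abel
  · ext x
    change D' (D x + B (C x)) - D' (B (E (C (D' (D x + B (C x)))))) = x
    rw [map_add, h2', map_add, map_add, e2', add_sub_cancel, add_sub_cancel_right]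

theorem StronglyStable.eq_zero_of_apply_eq {A : X →L[ℂ] X} (hA : StronglyStable A) {w : ℂ}
    (hw : ‖w‖ = 1) {x : X} (hx : A x = w • x) : x = 0 := by
  have h : ∀ n : ℕ, (A ^ n) x = w ^ n • x := by
    intro n
    induction n with
    | zero => simp
    | succ n ih =>
      rw [pow_succ']
      change A ((A ^ n) x) = _
      rw [ih, map_smul, hx, smul_smul, pow_succ]
  have h1 := (hA x).norm
  simp_rw [h, norm_smul, norm_pow, hw, one_pow, one_mul, norm_zero] at h1
  exact norm_eq_zero.1 (tendsto_nhds_unique tendsto_const_nhds h1)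

/-- A finite rank perturbation of an invertible operator is invertible if it is injective. -/
theorem isUnit_add_comp_of_injective {Y : Type*} [NormedAddCommGroup Y] [NormedSpace ℂ Y]
    [FiniteDimensional ℂ Y] {D : X →L[ℂ] X} (hD : IsUnit D) (B : Y →L[ℂ] X) (C : X →L[ℂ] Y)
    (h : ∀ x, D x + B (C x) = 0 → x = 0) : IsUnit (D + B ∘L C) := by
  obtain ⟨D', h1, h2⟩ := isUnit_iff_exists.1 hD
  have h1' : ∀ x, D (D' x) = x := fun x => DFunLike.congr_fun h1 x
  refine isUnit_add_comp h1 h2 B C ?_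
  have : CompleteSpace Y := FiniteDimensional.complete ℂ Y
  rw [ContinuousLinearMap.isUnit_iff_bijective]
  have hinj : Function.Injective (1 + C ∘L D' ∘L B : Y →L[ℂ] Y) := by
    rw [injective_iff_map_eq_zero]
    intro y hy
    have hy : y + C (D' (B y)) = 0 := hy
    have h3 : D' (B y) = 0 := by
      refine h _ ?_
      rw [h1', ← map_add, hy, map_zero]
    rwa [h3, map_zero, add_zero] at hy
  exact ⟨hinj, LinearMap.injective_iff_surjective (f := (1 + C ∘L D' ∘L B : Y →L[ℂ] Y).toLinearMap)
    |>.1 hinj⟩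

variable [CompleteSpace X]

/-- The factor `‖1‖` is kept because the operators on ℂ^p form the zero ring when p = 0. -/
theorem isUnit_one_sub_of_norm_le_half {𝔸 : Type*} [NormedRing 𝔸] [CompleteSpace 𝔸] {T : 𝔸}
    (hT : ‖T‖ ≤ 1 / 2) : IsUnit (1 - T) ∧ ‖Ring.inverse (1 - T)‖ ≤ 2 * ‖(1 : 𝔸)‖ := by
  have hu : IsUnit (1 - T) := isUnit_one_sub_of_norm_lt_one (by linarith)
  refine ⟨hu, ?_⟩
  have h := Ring.inverse_mul_cancel _ hu
  rw [mul_sub, mul_one, sub_eq_iff_eq_add] at h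
  have h1 : ‖Ring.inverse (1 - T)‖ ≤ ‖(1 : 𝔸)‖ + ‖Ring.inverse (1 - T)‖ * (1 / 2) := by
    calc ‖Ring.inverse (1 - T)‖ = ‖1 + Ring.inverse (1 - T) * T‖ := by rw [← h]
      _ ≤ _ := (norm_add_le _ _).trans (add_le_add_right ((norm_mul_le _ _).trans
        (mul_le_mul_of_nonneg_left hT (norm_nonneg _))) _)
  linarith

theorem StronglyStable.mem_resolventSet {A : X →L[ℂ] X} (hA : StronglyStable A) {z : ℂ}
    (hz : 1 < ‖z‖) : z ∈ resolventSet ℂ A :=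
  let ⟨_, hK⟩ := hA.exists_norm_pow_le
  (hasSum_resolvent hK hz).1

/-- An Abel-mean argument. Dividing w^n - A^n by w - A gives x = w^{-n}A^n x + (w - A)y; the first
part is controlled by (ρ - 1)‖R(ρw)‖ ≤ K, and R(ρw)(w - A)y is bounded in ρ, so the second is O(ρ -
1). -/
theorem norm_sub_smul_resolvent_apply_le {A : X →L[ℂ] X} {K : ℝ} (hK : ∀ n, ‖A ^ n‖ ≤ K)
    {w : ℂ} (hw : ‖w‖ = 1) (n : ℕ) (x : X) : ∃ D : ℝ, ∀ ρ : ℝ, 1 < ρ →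
      ‖(ρ * w - w) • resolvent A (ρ * w) x‖ ≤ K * ‖(A ^ n) x‖ + (ρ - 1) * D := by
  obtain ⟨Q, hQ⟩ : algebraMap ℂ (X →L[ℂ] X) w - A ∣ algebraMap ℂ (X →L[ℂ] X) w ^ n - A ^ n :=
    ⟨_, (Commute.mul_geom_sum₂ (Algebra.commutes w A) n).symm⟩
  set y := (w ^ n)⁻¹ • Q x with hy
  have hw0 : w ≠ 0 := norm_pos_iff.1 (hw ▸ one_pos)
  have hx : x = (w ^ n)⁻¹ • (A ^ n) x + (w • y - A y) := by
    have h1 : w ^ n • x - (A ^ n) x = w • Q x - A (Q x) := by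
      have := DFunLike.congr_fun hQ x
      rw [← map_pow] at this
      simpa [Algebra.algebraMap_eq_smul_one] using this
    have h2 : w • y - A y = (w ^ n)⁻¹ • (w ^ n • x - (A ^ n) x) := by
      rw [h1, hy, map_smul, smul_sub, smul_comm]
    rw [h2, smul_sub, inv_smul_smul₀ (pow_ne_zero n hw0)]
    abel
  refine ⟨‖y‖ + K * ‖y‖, fun ρ hρ => ?_⟩
  have hn : ‖(ρ * w : ℂ)‖ = ρ := by
    rw [norm_mul, hw, mul_one, norm_real, Real.norm_of_nonneg (by linarith)]
  have hρz : 1 < ‖(ρ * w : ℂ)‖ := by rwa [hn]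
  have hm := (hasSum_resolvent hK hρz).1
  have hd : ‖(ρ * w - w : ℂ)‖ = ρ - 1 := by
    rw [← sub_one_mul, norm_mul, hw, mul_one, ← ofReal_one, ← ofReal_sub, norm_real,
      Real.norm_of_nonneg (by linarith)]
  set G := resolvent A (ρ * w : ℂ) with hG
  have hb : ∀ v, ‖(ρ * w - w : ℂ) • G v‖ ≤ K * ‖v‖ := by
    intro v
    have h1 := norm_resolvent_le hK hρz
    rw [hn] at h1
    have hρ1 : 0 < ρ - 1 := by linarith
    rw [norm_smul, hd]
    calc (ρ - 1) * ‖G v‖ ≤ (ρ - 1) * (K / (ρ - 1) * ‖v‖) := by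
          refine mul_le_mul_of_nonneg_left ?_ hρ1.le
          exact (G.le_opNorm v).trans (mul_le_mul_of_nonneg_right h1 (norm_nonneg _))
      _ = K * ‖v‖ := by field_simp
  have hGy : G (w • y - A y) = y - (ρ * w - w : ℂ) • G y := by
    have h1 : G ((ρ * w : ℂ) • y - A y) = y := by
      have := DFunLike.congr_fun (resolvent_mul_sub hm) y
      simpa [Algebra.algebraMap_eq_smul_one] using this
    rw [eq_sub_iff_add_eq, ← map_smul, ← map_add, sub_smul]
    rw [← h1]
    congr 1
    rw [h1]
    abel
  have hx2 : (ρ * w - w : ℂ) • G x = (ρ * w - w : ℂ) • G ((w ^ n)⁻¹ • (A ^ n) x) +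
      (ρ * w - w : ℂ) • (y - (ρ * w - w : ℂ) • G y) := by
    rw [← hGy, ← smul_add, ← map_add, ← hx]
  rw [hx2]
  refine (norm_add_le _ _).trans (add_le_add ((hb _).trans_eq ?_) ?_)
  · rw [norm_smul, norm_inv, norm_pow, hw, one_pow, inv_one, one_mul]
  · rw [norm_smul, hd]
    exact mul_le_mul_of_nonneg_left ((norm_sub_le _ _).trans (add_le_add_right (hb y) _))
      (by linarith)

/-- An eigenvector of `A + BC` for an eigenvalue `w` on the unit circle vanishes, if the operators
`1 - C R(ρ w, A) B`, `ρ > 1`, have uniformly bounded inverses. -/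
theorem StronglyStable.eq_zero_of_add_comp_apply_eq {A : X →L[ℂ] X} (hA : StronglyStable A)
    {Y : Type*} [NormedAddCommGroup Y] [NormedSpace ℂ Y] (B : Y →L[ℂ] X) (C : X →L[ℂ] Y)
    {w : ℂ} (hw : ‖w‖ = 1) {M : ℝ}
    (hM : ∀ ρ : ℝ, 1 < ρ → IsUnit (1 - C ∘L resolvent A (ρ * w) ∘L B) ∧
      ‖Ring.inverse (1 - C ∘L resolvent A (ρ * w) ∘L B)‖ ≤ M)
    {x : X} (hx : A x + B (C x) = w • x) : x = 0 := by
  obtain ⟨K, hK⟩ := hA.exists_norm_pow_le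
  have hM0 : 0 ≤ M := (norm_nonneg _).trans (hM 2 (by norm_num)).2
  have key : ∀ ρ : ℝ, 1 < ρ → ‖C x‖ ≤ M * (‖C‖ * ‖(ρ * w - w) • resolvent A (ρ * w) x‖) := by
    intro ρ hρ
    obtain ⟨hu, hb⟩ := hM ρ hρ
    have hρz : 1 < ‖(ρ * w : ℂ)‖ := by
      rwa [norm_mul, hw, mul_one, norm_real, Real.norm_of_nonneg (by linarith)]
    have hm := hA.mem_resolventSet hρz
    set G := resolvent A (ρ * w : ℂ)
    have h1 : G ((ρ * w : ℂ) • x - A x) = x := by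
      have := DFunLike.congr_fun (resolvent_mul_sub hm) x
      simpa [Algebra.algebraMap_eq_smul_one] using this
    have h2 : G (B (C x)) = x - (ρ * w - w) • G x := by
      rw [← eq_sub_iff_add_eq'] at hx
      rw [hx, eq_sub_iff_add_eq, ← map_smul, ← map_add, sub_smul, ← h1]
      congr 1
      rw [h1]
      abel
    -- The eigenvalue equation bounds Cx, through the inverse of 1 - CGB, by an Abel mean that tends
    -- to 0.
    have h3 : (1 - C ∘L G ∘L B) (C x) = C ((ρ * w - w) • G x) := by
      change C x - C (G (B (C x))) = _
      rw [h2, map_sub, sub_sub_cancel]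
    have h4 : C x = Ring.inverse (1 - C ∘L G ∘L B) (C ((ρ * w - w) • G x)) := by
      rw [← h3]
      exact (DFunLike.congr_fun (Ring.inverse_mul_cancel _ hu) (C x)).symm
    calc ‖C x‖ = ‖Ring.inverse (1 - C ∘L G ∘L B) (C ((ρ * w - w) • G x))‖ := by rw [← h4]
      _ ≤ M * ‖C ((ρ * w - w) • G x)‖ :=
          (ContinuousLinearMap.le_opNorm _ _).trans (mul_le_mul_of_nonneg_right hb (norm_nonneg _))
      _ ≤ _ := mul_le_mul_of_nonneg_left (C.le_opNorm _) hM0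
  -- The limit ρ → 1 is taken for fixed n, since D depends on n; only afterwards n → ∞.
  have key2 : ∀ n : ℕ, ‖C x‖ ≤ M * (‖C‖ * (K * ‖(A ^ n) x‖)) := by
    intro n
    obtain ⟨D, hD⟩ := norm_sub_smul_resolvent_apply_le hK hw n x
    have hlim : Filter.Tendsto (fun ρ : ℝ => M * (‖C‖ * (K * ‖(A ^ n) x‖ + (ρ - 1) * D)))
        (nhdsWithin 1 (Set.Ioi 1)) (nhds (M * (‖C‖ * (K * ‖(A ^ n) x‖ + (1 - 1) * D)))) :=
      Filter.Tendsto.mono_left (Continuous.tendsto (by fun_prop) 1) nhdsWithin_le_nhds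
    rw [sub_self, zero_mul, add_zero] at hlim
    refine ge_of_tendsto hlim ?_
    filter_upwards [self_mem_nhdsWithin] with ρ hρ
    refine (key ρ hρ).trans ?_
    gcongr
    exact hD ρ hρ
  have hC : C x = 0 := by
    have hlim := ((((hA x).norm.const_mul K).const_mul ‖C‖).const_mul M)
    simp only [norm_zero, mul_zero] at hlim
    exact norm_le_zero_iff.1 (ge_of_tendsto' hlim key2)
  rw [hC, map_zero, add_zero] at hx
  exact hA.eq_zero_of_apply_eq hw hx

end Perturbation

/-! ### The uniform bound outside the disc -/

theorem angle_eq_of_circlePt_eq {φ ψ : ℝ} (h : circlePt φ = circlePt ψ) :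
    (φ : Real.Angle) = ψ := by
  obtain ⟨n, hn⟩ := exp_eq_exp_iff_exists_int.1 h
  refine Real.Angle.angle_eq_iff_two_pi_dvd_sub.2 ⟨n, ?_⟩
  have h1 : (φ : ℂ) = ψ + n * (2 * Real.pi) := by
    refine mul_right_cancel₀ I_ne_zero ?_
    rw [hn]
    ring
  have h2 : φ = ψ + n * (2 * Real.pi) := by exact_mod_cast h1
  rw [h2]
  ring

theorem arcDist_congr {φ ψ θ : ℝ} (h : circlePt φ = circlePt ψ) : arcDist φ θ = arcDist ψ θ := by
  rw [arcDist, arcDist, Real.Angle.coe_sub, Real.Angle.coe_sub, angle_eq_of_circlePt_eq h]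

theorem arcDist_self (φ : ℝ) : arcDist φ φ = 0 := by
  simp [arcDist]

section Assumption

variable {X : Type*} [NormedAddCommGroup X] [InnerProductSpace ℂ X] {A : X →L[ℂ] X}
  {N : ℕ} {φ : Fin N → ℝ} {α : ℝ}

theorem norm_circlePt_smul_pow (A : X →L[ℂ] X) (ψ : ℝ) (n : ℕ) :
    ‖(circlePt ψ • A) ^ n‖ = ‖A ^ n‖ := by
  rw [smul_pow, norm_smul, norm_pow, norm_circlePt, one_pow, one_mul]

theorem SemigroupAssumption.mem_resolventSet (hA : SemigroupAssumption A φ α) {z : ℂ}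
    (hz : ‖z‖ = 1) (h : ∀ k, z ≠ circlePt (φ k)) : z ∈ resolventSet ℂ A := by
  by_contra hs
  have : z ∈ spectrum ℂ A ∩ Metric.sphere (0 : ℂ) 1 := ⟨hs, by simpa using hz⟩
  rw [hA.spec] at this
  obtain ⟨k, hk⟩ := this
  exact h k hk.symm

theorem SemigroupAssumption.circlePt_mem_spectrum (hA : SemigroupAssumption A φ α) (k : Fin N) :
    circlePt (φ k) ∈ spectrum ℂ A := by
  have : circlePt (φ k) ∈ spectrum ℂ A ∩ Metric.sphere (0 : ℂ) 1 := by
    rw [hA.spec]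
    exact ⟨k, rfl⟩
  exact this.1

theorem circlePt_ne_of_arcDist_le {ε : ℝ} (hε : 0 < ε)
    (hsep : ∀ k l, k ≠ l → ε ≤ arcDist (φ k) (φ l) / 3) {θ : ℝ} {k : Fin N}
    (h0 : 0 < arcDist θ (φ k)) (h1 : arcDist θ (φ k) ≤ ε) (l : Fin N) :
    circlePt θ ≠ circlePt (φ l) := by
  intro h
  rw [arcDist_congr h] at h0 h1
  rcases eq_or_ne l k with rfl | hlk
  · rw [arcDist_self] at h0
    exact h0.false
  · linarith [hsep l k hlk]

variable [CompleteSpace X]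

theorem commute_fracPow {a b : X →L[ℂ] X} {K : ℝ} (hK : ∀ n, ‖a ^ n‖ ≤ K) (r : ℝ)
    (h : Commute a b) : Commute (fracPow (1 - a) r) b := by
  obtain ⟨κ, hκ⟩ := exists_fracPow_eq_smul hK r
  rw [hκ]
  have h1 : Commute (1 - a) b := (Commute.one_left b).sub_left h
  exact ((h1.pow_left _).mul_left (commute_powSeries hK (Int.fract_nonneg r)
    (Int.fract_lt_one r).le h)).smul_left κ

theorem SemigroupAssumption.exists_norm_resolvent_circlePt_mul_le
    (hA : SemigroupAssumption A φ α) (hα : 1 ≤ α) {β γ : ℝ} (hβ : 0 ≤ β) (hγ : 0 ≤ γ)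
    (h : α ≤ β + γ) {M ε : ℝ} (hε : 0 < ε) (hε1 : ε ≤ Real.pi / 8)
    (hsep : ∀ k l, k ≠ l → ε ≤ arcDist (φ k) (φ l) / 3)
    (hM : ∀ k, ∀ θ : ℝ, 0 < arcDist θ (φ k) → arcDist θ (φ k) ≤ ε →
      arcDist θ (φ k) ^ α * ‖resolvent A (circlePt θ)‖ ≤ M) (k : Fin N) :
    ∃ D : ℝ, ∀ θ : ℝ, 0 < arcDist θ (φ k) → arcDist θ (φ k) ≤ ε →
      ‖resolvent A (circlePt θ) * (fracPow (Lam A (φ k)) γ * fracPow (Lam A (φ k)) β)‖ ≤ D := by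
  obtain ⟨K, hK⟩ := hA.stable.exists_norm_pow_le
  set a := circlePt (-φ k) • A with ha
  have hKa : ∀ n, ‖a ^ n‖ ≤ K := fun n => by rw [ha, norm_circlePt_smul_pow]; exact hK n
  have hL : Lam A (φ k) = 1 - a := rfl
  obtain ⟨κ, hκ⟩ := exists_fracPow_eq_smul hKa γ
  obtain ⟨κ', hκ'⟩ := exists_fracPow_eq_smul hKa β
  have hfl : ∀ {r : ℝ}, 0 ≤ r → (⌊r⌋₊ : ℝ) + Int.fract r = r := fun hr => by
    rw [natCast_floor_eq_intCast_floor hr, Int.floor_add_fract]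
  obtain ⟨D, hD⟩ := exists_norm_resolvent_mul_le (M := M) hKa hα ⌊γ⌋₊ ⌊β⌋₊
    (Int.fract_nonneg γ) (Int.fract_lt_one γ) (Int.fract_nonneg β) (Int.fract_lt_one β)
    (by rw [hfl hβ, hfl hγ]; linarith)
  refine ⟨‖κ‖ * ‖κ'‖ * D, fun θ h0 h1 => ?_⟩
  have hθ : circlePt θ ∈ resolventSet ℂ A := hA.mem_resolventSet (norm_circlePt θ)
    (circlePt_ne_of_arcDist_le hε hsep h0 h1)
  obtain ⟨hz, hres⟩ := mem_resolventSet_smul (circlePt_ne_zero (-φ k)) hθ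
  rw [← circlePt_add, neg_add_eq_sub] at hz hres
  have hz1 : circlePt (θ - φ k) ≠ 1 := by
    intro hone
    refine circlePt_ne_of_arcDist_le hε hsep h0 h1 k ?_
    rw [← sub_add_cancel θ (φ k), circlePt_add, hone, one_mul]
  have hd := norm_circlePt_sub_one_le θ (φ k)
  -- This gives ε ≤ π/8 < 1/2, so |z - 1| ≤ 1 as the local estimate requires.
  have hpi := Real.pi_lt_four
  have hb := hD _ hz hz1 (by linarith) (fun t ht => add_norm_sub_one_le (norm_circlePt _) ht) ?_
  · rw [hL, hκ, hκ', smul_mul_smul_comm, mul_smul_comm, norm_smul, norm_mul, hres, smul_mul_assoc,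
      norm_smul, norm_circlePt, one_mul]
    gcongr
  · refine le_trans ?_ (hM k θ h0 h1)
    rw [hres, norm_smul, norm_circlePt, one_mul]
    gcongr

/-- The index may depend on z while the bound may not; this suffices, because C R(z,A) B factors
through the powers of Λ_k for every k. -/
theorem SemigroupAssumption.exists_norm_resolvent_mul_le
    (hA : SemigroupAssumption A φ α) (hN : 1 ≤ N) (hα : 1 ≤ α) {β γ : ℝ} (hβ : 0 ≤ β)
    (hγ : 0 ≤ γ) (h : α ≤ β + γ) :
    ∃ D : ℝ, 0 ≤ D ∧ ∀ z : ℂ, z ∉ Metric.ball (0 : ℂ) 1 ∪ Set.range (fun k => circlePt (φ k)) →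
      z ∈ resolventSet ℂ A ∧ ∃ k : Fin N, ‖resolvent A z *
        (fracPow (Lam A (φ k)) γ * fracPow (Lam A (φ k)) β)‖ ≤ D := by
  obtain ⟨K, hK⟩ := hA.stable.exists_norm_pow_le
  have hK0 : 0 ≤ K := (norm_nonneg _).trans (hK 0)
  obtain ⟨M, ε, hM1, hε, hε1, hsep, hnear, hfar⟩ := hA.growth
  choose D hD using hA.exists_norm_resolvent_circlePt_mul_le hα hβ hγ h hε hε1 hsep hnear
  set P : Fin N → X →L[ℂ] X := fun k => fracPow (Lam A (φ k)) γ * fracPow (Lam A (φ k)) β with hP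
  have hDsum : ∀ k, D k ≤ ∑ k, |D k| := fun k =>
    (le_abs_self _).trans (Finset.single_le_sum (f := fun k => |D k|)
      (fun _ _ => abs_nonneg _) (Finset.mem_univ k))
  -- Far from all the points e^{iφ_k} any index serves.
  let k₀ : Fin N := ⟨0, hN⟩
  refine ⟨(1 + K) * (∑ k, |D k| + M * ‖P k₀‖), by positivity, fun z hz => ?_⟩
  simp only [Set.mem_union, Metric.mem_ball, dist_zero_right, Set.mem_range, not_or, not_lt,
    not_exists] at hz
  obtain ⟨hz1, hzφ⟩ := hz
  set θ := arg z with hθ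
  have hzθ : z = (‖z‖ : ℂ) * circlePt θ := (norm_mul_exp_arg_mul_I z).symm
  have hzA : z ∈ resolventSet ℂ A := by
    rcases hz1.eq_or_lt with h1 | h1
    · exact hA.mem_resolventSet h1.symm fun k hk => hzφ k hk.symm
    · exact hA.stable.mem_resolventSet h1
  refine ⟨hzA, ?_⟩
  by_cases hc : ∀ k, ε < arcDist θ (φ k)
  · have hθA : circlePt θ ∈ resolventSet ℂ A := hA.mem_resolventSet (norm_circlePt θ) fun k hk => by
      have := hc k
      rw [arcDist_congr hk, arcDist_self] at this
      linarith
    refine ⟨k₀, ?_⟩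
    rw [hzθ]
    refine (norm_resolvent_mul_le_of_norm_eq_one hK (norm_circlePt θ) hθA _ hz1).trans ?_
    refine mul_le_mul_of_nonneg_left ?_ (by linarith)
    refine le_add_of_nonneg_of_le (by positivity) ((norm_mul_le _ _).trans ?_)
    exact mul_le_mul_of_nonneg_right (hfar θ hc) (norm_nonneg _)
  · push Not at hc
    obtain ⟨k, hk⟩ := hc
    refine ⟨k, ?_⟩
    have key : ∀ ψ : ℝ, 0 < arcDist ψ (φ k) → arcDist ψ (φ k) ≤ ε →
        ‖resolvent A (‖z‖ * circlePt ψ) * P k‖ ≤ (1 + K) * (∑ k, |D k| + M * ‖P k₀‖) := by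
      intro ψ h0 h1
      refine (norm_resolvent_mul_le_of_norm_eq_one hK (norm_circlePt ψ)
        (hA.mem_resolventSet (norm_circlePt ψ) (circlePt_ne_of_arcDist_le hε hsep h0 h1))
        _ hz1).trans ?_
      refine mul_le_mul_of_nonneg_left ?_ (by linarith)
      exact le_add_of_le_of_nonneg ((hD k ψ h0 h1).trans (hDsum k)) (by positivity)
    -- On the ray through e^{iφ_k} no comparison with the circle point is possible, as it lies in
    -- the spectrum. The bound comes from nearby rays by continuity of the resolvent at z.
    rcases (norm_nonneg ((θ - φ k : ℝ) : Real.Angle)).eq_or_lt with h0 | h0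
    · have hzk : z = (‖z‖ : ℂ) * circlePt (φ k) := by
        rw [← circlePt_eq_of_arcDist_eq_zero h0.symm]
        exact hzθ
      have hcont : ContinuousAt (fun ψ : ℝ => ‖resolvent A (‖z‖ * circlePt ψ) * P k‖) (φ k) := by
        refine ContinuousAt.norm (ContinuousAt.mul ?_ continuousAt_const)
        refine ContinuousAt.comp (f := fun ψ : ℝ => (‖z‖ : ℂ) * circlePt ψ)
          (continuousAt_resolvent (hzk ▸ hzA)) ?_
        unfold circlePt
        fun_prop
      have hlim := hcont.tendsto.mono_left (nhdsWithin_le_nhds (s := Set.Ioi (φ k)))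
      rw [← hzk] at hlim
      refine le_of_tendsto hlim ?_
      filter_upwards [Ioo_mem_nhdsGT (show φ k < φ k + ε by linarith)] with ψ hψ
      have hpos : 0 < ψ - φ k := sub_pos.2 hψ.1
      have hlt : ψ - φ k < ε := by linarith [hψ.2]
      have hd : arcDist ψ (φ k) = ψ - φ k := by
        rw [arcDist_eq_abs] <;> rw [abs_of_pos hpos]
        linarith [Real.pi_pos]
      exact key ψ (by rwa [hd]) (by rw [hd]; exact hlt.le)
    · rw [hzθ]
      exact key θ h0 hk

/-- Write B = Λ^β B₀ and, taking adjoints of C* = (Λ*)^γ C₀, C = C₀* Λ^γ; then move Λ^γ past the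
resolvent. -/
theorem comp_resolvent_comp_eq {Y : Type*} [NormedAddCommGroup Y] [InnerProductSpace ℂ Y]
    [FiniteDimensional ℂ Y] [CompleteSpace Y] {K : ℝ} (hK : ∀ n, ‖A ^ n‖ ≤ K) (ψ β γ : ℝ)
    {B : Y →L[ℂ] X} {C : X →L[ℂ] Y}
    (hB : Set.range B ⊆ Set.range (fracPow (Lam A ψ) β))
    (hC : Set.range (ContinuousLinearMap.adjoint C) ⊆
      Set.range (fracPow (ContinuousLinearMap.adjoint (Lam A ψ)) γ))
    {z : ℂ} (hz : z ∈ resolventSet ℂ A) :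
    C ∘L resolvent A z ∘L B =
      ContinuousLinearMap.adjoint (invComp (fracPow (ContinuousLinearMap.adjoint (Lam A ψ)) γ)
        (ContinuousLinearMap.adjoint C)) ∘L
      (resolvent A z * (fracPow (Lam A ψ) γ * fracPow (Lam A ψ) β)) ∘L
      invComp (fracPow (Lam A ψ) β) B := by
  have hKa : ∀ n, ‖(circlePt (-ψ) • A) ^ n‖ ≤ K := fun n => by
    rw [norm_circlePt_smul_pow]; exact hK n
  set C₀ := invComp (fracPow (ContinuousLinearMap.adjoint (Lam A ψ)) γ)
    (ContinuousLinearMap.adjoint C) with hC₀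
  set B₀ := invComp (fracPow (Lam A ψ) β) B with hB₀
  have e1 : fracPow (Lam A ψ) β ∘L B₀ = B := comp_invComp _ _ hB
  have e2 : C = ContinuousLinearMap.adjoint C₀ ∘L fracPow (Lam A ψ) γ := by
    have h1 := congrArg ContinuousLinearMap.adjoint
      (comp_invComp (fracPow (ContinuousLinearMap.adjoint (Lam A ψ)) γ) _ hC)
    rw [ContinuousLinearMap.adjoint_comp, ContinuousLinearMap.adjoint_adjoint] at h1
    rw [← h1]
    congr 1
    exact (star_fracPow hKa γ)
  have hc : Commute (fracPow (Lam A ψ) γ) (resolvent A z) :=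
    commute_fracPow hKa γ ((commute_resolvent (Commute.refl A) hz).symm.smul_left _)
  conv_lhs => rw [e2, ← e1]
  rw [← mul_assoc, ← hc.eq]
  rfl

end Assumption

end

/-! ### The perturbation theorem -/

theorem theorem3 {X : Type*} [NormedAddCommGroup X] [InnerProductSpace ℂ X] [CompleteSpace X]
    (A : X →L[ℂ] X) {N : ℕ} (hN : 1 ≤ N) (φ : Fin N → ℝ) (α β γ : ℝ)
    (hα : 1 ≤ α) (hβ : 0 ≤ β) (hγ : 0 ≤ γ) (hA : SemigroupAssumption A φ α)
    (hαβγ : α ≤ β + γ) :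
    ∃ δ : ℝ, 0 < δ ∧
      ∀ (p : ℕ) (B : EuclideanSpace ℂ (Fin p) →L[ℂ] X) (C : X →L[ℂ] EuclideanSpace ℂ (Fin p)),
        PerturbationAssumption A φ β γ B C →
        (∀ k, ‖invComp (fracPow (Lam A (φ k)) β) B‖ < δ) →
        (∀ k, ‖invComp (fracPow (ContinuousLinearMap.adjoint (Lam A (φ k))) γ)
          (ContinuousLinearMap.adjoint C)‖ < δ) →
        spectrum ℂ (A + B ∘L C) ⊆
            Metric.ball (0 : ℂ) 1 ∪ Set.range (fun k => circlePt (φ k)) ∧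
        (∀ k, circlePt (φ k) ∈ spectrum ℂ (A + B ∘L C) ∧
          ¬ Module.End.HasEigenvalue ((A + B ∘L C : X →L[ℂ] X) : Module.End ℂ X)
            (circlePt (φ k))) ∧
        ∃ M : ℝ, ∀ z : ℂ,
          z ∉ Metric.ball (0 : ℂ) 1 ∪ Set.range (fun k => circlePt (φ k)) →
          z ∈ resolventSet ℂ A ∧
          IsUnit (1 - C ∘L resolvent A z ∘L B) ∧
          ‖Ring.inverse (1 - C ∘L resolvent A z ∘L B)‖ ≤ M := by
  obtain ⟨K, hK⟩ := hA.stable.exists_norm_pow_le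
  obtain ⟨D, hD0, hD⟩ := hA.exists_norm_resolvent_mul_le hN hα hβ hγ hαβγ
  -- Then δ ≤ 1 and δD ≤ 1/2, hence δ²D ≤ 1/2; the added 1 covers D = 0.
  refine ⟨1 / (2 * (D + 1)), by positivity, fun p B C hBC hB hC => ?_⟩
  set δ := 1 / (2 * (D + 1)) with hδ
  have hδD : δ * (D * δ) ≤ 1 / 2 := by
    have h1 : δ * (D + 1) = 1 / 2 := by rw [hδ]; field_simp
    have h2 : 0 < δ := by positivity
    have h3 : δ ≤ 1 := by nlinarith [mul_nonneg h2.le hD0]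
    nlinarith [mul_nonneg h2.le hD0, mul_le_mul_of_nonneg_left h3 (mul_nonneg h2.le hD0)]
  have hsmall : ∀ z : ℂ, z ∉ Metric.ball (0 : ℂ) 1 ∪ Set.range (fun k => circlePt (φ k)) →
      ‖C ∘L resolvent A z ∘L B‖ ≤ 1 / 2 := by
    intro z hz
    obtain ⟨hzA, k, hk⟩ := hD z hz
    rw [comp_resolvent_comp_eq hK (φ k) β γ (hBC.range_B k) (hBC.range_C k) hzA]
    refine (ContinuousLinearMap.opNorm_comp_le _ _).trans (le_trans ?_ hδD)
    rw [LinearIsometryEquiv.norm_map]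
    refine mul_le_mul (hC k).le ((ContinuousLinearMap.opNorm_comp_le _ _).trans ?_)
      (norm_nonneg _) (by positivity)
    exact mul_le_mul hk (hB k).le (norm_nonneg _) hD0
  have hinv : ∀ z : ℂ, z ∉ Metric.ball (0 : ℂ) 1 ∪ Set.range (fun k => circlePt (φ k)) →
      z ∈ resolventSet ℂ A ∧ IsUnit (1 - C ∘L resolvent A z ∘L B) ∧
      ‖Ring.inverse (1 - C ∘L resolvent A z ∘L B)‖ ≤
        2 * ‖(1 : EuclideanSpace ℂ (Fin p) →L[ℂ] EuclideanSpace ℂ (Fin p))‖ := fun z hz =>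
    ⟨(hD z hz).1, isUnit_one_sub_of_norm_le_half (hsmall z hz)⟩
  refine ⟨fun z hz => ?_, fun k => ?_, _, hinv⟩
  · by_contra hzn
    obtain ⟨hzA, hu, -⟩ := hinv z hzn
    refine hz ?_
    have h1 : IsUnit ((algebraMap ℂ (X →L[ℂ] X) z - A) + (-B) ∘L C) := by
      refine isUnit_add_comp (sub_mul_resolvent hzA) (resolvent_mul_sub hzA) _ _ ?_
      rwa [ContinuousLinearMap.comp_neg, ContinuousLinearMap.comp_neg, ← sub_eq_add_neg]
    rwa [ContinuousLinearMap.neg_comp, ← sub_eq_add_neg, sub_sub] at h1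
  · have hw := norm_circlePt (φ k)
    constructor
    · intro hu
      refine hA.circlePt_mem_spectrum k ?_
      -- Roles are exchanged: w - A is the perturbation of w - (A + BC), supposed invertible, and it
      -- is injective by stability.
      have h1 := isUnit_add_comp_of_injective hu B C fun x hx => ?_
      · have e : algebraMap ℂ (X →L[ℂ] X) (circlePt (φ k)) - (A + B ∘L C) + B ∘L C =
            algebraMap ℂ (X →L[ℂ] X) (circlePt (φ k)) - A := by abel
        rwa [e] at h1
      · refine hA.stable.eq_zero_of_apply_eq hw ?_
        have h2 : circlePt (φ k) • x - (A x + B (C x)) + B (C x) = 0 := by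
          simpa [Algebra.algebraMap_eq_smul_one] using hx
        rw [← sub_eq_zero, ← neg_eq_zero, ← h2]
        abel
    · intro hev
      obtain ⟨x, hx⟩ := hev.exists_hasEigenvector
      refine hx.2 (hA.stable.eq_zero_of_add_comp_apply_eq B C hw
        (fun ρ hρ => (hinv (ρ * circlePt (φ k)) ?_).2) hx.apply_eq_smul)
      have hn : ‖(ρ * circlePt (φ k) : ℂ)‖ = ρ := by
        rw [norm_mul, hw, mul_one, norm_real, Real.norm_of_nonneg (by linarith)]
      rintro (hb | ⟨l, hl⟩)
      · rw [mem_ball_zero_iff, hn] at hb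
        linarith
      · have : ‖circlePt (φ l)‖ = ρ := by rw [← hn, ← hl]
        rw [norm_circlePt] at this
        linarith
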